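/- Let $G$ and $H$ be finitely generated groups such that the knapsack problem $\mathrm{KP}(H)$ is decidable. Then for every knapsack expression over the wreath product $G\wr H$ one can effectively construct an equivalent finite set of normalized $\mathrm{HKP}^+(G\wr H)$-instances. Here $G\wr H$ consists of the pairs $(f,h)$ with $h\in H$ and $f\colon H\to G$ of finite support, with multiplication $(f_1,h_1)(f_2,h_2)=(x\mapsto f_1(x)f_2(h_1^{-1}x),\,h_1h_2)$, and $\sigma\colon G\wr H\to H$ is the projection $(f,h)\mapsto h$; $H$ is the subgroup of the pairs $(1,h)$, and $g\in G$ is identified with $(f,1)$ where $f(1)=g$ and $f(x)=1$ for $x\ne 1$; elements of $H$ and of $G\wr H$ are given as words over fixed finite generating tuples of $H$, respectively of $G$ and $H$, and their inverses. A knapsack expression over a group $K$ is a formal product $E=\alpha_1\cdots\alpha_n$ in which each atom $\alpha_i$ is a constant $g_i\in K$ or a power $g_i^{x_i}$ with base $g_i\in K$ and a variable $x_i$, no variable occurring twice; for a valuation $\nu$ of the variables in $\mathbb N$, $\nu(E)\in K$ is obtained by replacing each variable $x$ by $\nu(x)$, and $\nu$ is a solution of $E$ if $\nu(E)=1$; $\mathrm{KP}(K)$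 asks whether a given knapsack expression over $K$ has a solution. The factorized walk $\pi_1\cdots\pi_n$ induced by $\nu$ on $E$ is given by $\pi_i=(\nu(\alpha_1\cdots\alpha_{i-1})g_i^k)_{0\le k\le\ell_i}$, where $\ell_i=\nu(x_i)$ if $\alpha_i=g_i^{x_i}$ and $\ell_i=1$ if $\alpha_i=g_i$; a walk is a loop if its first and last elements are equal. An $\mathrm{HKP}^+(G\wr H)$-instance is a pair $(E,L)$ of a knapsack expression $E=\alpha_1\cdots\alpha_n$ over $G\wr H$ and a finite set $L$ of pairs $(i,j)$ with $0\le i<j\le n$; a solution of it is a valuation $\nu$ with $\nu(E)=1$ such that $\sigma(\pi_{i+1}\cdots\pi_j)$ is a loop for all $(i,j)\in L$. A knapsack expression is equivalent to a finite set of $\mathrm{HKP}^+(G\wr H)$-instances if it has a solution if and only if at least one of the instances has a solution. An instance $(E,L)$ is normalized if $E=\alpha_1\cdots\alpha_n\alpha_{n+1}$ ($n\ge 0$) is torsion-free (for every power with base $g$ in $E$, $\sigma(g)=1$ or $\sigma(g)$ has infinite order), in $GH$-form ($\alpha_{n+1}$ is a constant, for every power with base $g$ in $E$ we have $\sigma(g)=1$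 or $g\in GH$, and all constants among $\alpha_1,\dots,\alpha_n$ lie in $H$), and c-simplified (if $g,g'\notin H$ are bases of powers in $E$ and $\sigma(g)$, $\sigma(g')$ are commensurable, that is, $\sigma(g)^a=\sigma(g')^b$ for some $a,b\in\mathbb Z\setminus\{0\}$, then $\sigma(g)=\sigma(g')$). -/

import Mathlib

namespace WreathKnapsack

/-! ### Words over generators -/

/-- Words over a set `α` of generators and their formal inverses: the letter `(a, true)` stands for
the generator `a` and the letter `(a, false)` for its inverse. -/
abbrev Word (α : Type) := List (α × Bool)

/-- The group element represented by a word. -/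
def wordEval {α : Type} {K : Type*} [Group K] (gen : α → K) (w : Word α) : K :=
  (w.map fun l => if l.2 then gen l.1 else (gen l.1)⁻¹).prod

/-! ### Knapsack expressions -/

/-- An atom: `(g, none)` is the constant `g`, and `(g, some x)` is the power `g ^ x` with base `g`
and variable `x`. In both cases `γ (α)` is the first component. -/
abbrev Atom (K : Type*) := K × Option ℕ

/-- An exponent expression `α₁ ⋯ αₙ`, a formal product of atoms. -/
abbrev Expr (K : Type*) := List (Atom K)

namespace Expr

/-- The list of occurrences of variables in an expression. -/
def vars {K : Type*} (E : Expr K) : List ℕ := E.filterMap Prod.snd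

/-- A knapsack expression is an exponent expression in which every variable occurs at most once. -/
def IsKnapsack {K : Type*} (E : Expr K) : Prop := E.vars.Nodup

/-- Replace the elements (for instance words) in an expression by their images. -/
def map {K L : Type*} (f : K → L) (E : Expr K) : Expr L :=
  List.map (fun a => (f a.1, a.2)) E

end Expr

/-- The number of steps of an atom under a valuation: `ν x` for a power `g ^ x`, and `1` for a
constant. -/
def atomLength {K : Type*} (ν : ℕ → ℕ) (a : Atom K) : ℕ :=
  match a.2 with
  | none => 1
  | some x => ν x

section Group

variable {K : Type*} [Group K]

/-- The value `ν (α)` of an atom: `g` for a constant `g`, and `g ^ ν x` for a power `g ^ x`. -/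
def atomEval (ν : ℕ → ℕ) (a : Atom K) : K := a.1 ^ atomLength ν a

/-- The value `ν (E) = ν (α₁) ⋯ ν (αₙ)` of an expression. -/
def Expr.eval (ν : ℕ → ℕ) (E : Expr K) : K := (List.map (atomEval ν) E).prod

/-- The solutions of a knapsack expression. A valuation is given on all of `ℕ`; only its values on
the variables of `E` matter. -/
def Expr.sol (E : Expr K) : Set (ℕ → ℕ) := {ν | E.eval ν = 1}

/-- The walk `(p, p g, p g², …, p gˡ)`. -/
def progression (p g : K) (l : ℕ) : List K := (List.range (l + 1)).map fun i => p * g ^ i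

/-- The factorized walk `π₁ ⋯ πₙ` induced by `ν` on `E = α₁ ⋯ αₙ`: the walk `πᵢ` starts in
`ν (α₁ ⋯ αᵢ₋₁)`, and makes `ν x` steps with `g` if `αᵢ = g ^ x` and one step with `g` if `αᵢ = g`. -/
def Expr.factorizedWalk (ν : ℕ → ℕ) (E : Expr K) : List (List K) :=
  E.mapIdx fun i a => progression (Expr.eval ν (E.take i)) a.1 (atomLength ν a)

/-- The concatenation of a list of walks, each of which starts where the preceding one ends. -/
def walkConcat : List (List K) → List K
  | [] => []
  | π :: ρs => π ++ ρs.flatMap List.tail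

/-- The walk `πᵢ₊₁ ⋯ πⱼ` for the factorized walk `π₁ ⋯ πₙ` induced by `ν` on `E`. -/
def Expr.segment (ν : ℕ → ℕ) (E : Expr K) (i j : ℕ) : List K :=
  walkConcat (((E.factorizedWalk ν).take j).drop i)

/-- A walk is a loop if it ends where it starts. -/
def IsLoop (π : List K) : Prop := π.head? = π.getLast?

/-- Two elements are commensurable if they have a common power with nonzero exponents. -/
def Commensurable (g h : K) : Prop := ∃ a b : ℤ, a ≠ 0 ∧ b ≠ 0 ∧ g ^ a = h ^ b

end Group

/-- Decidability of `KP(H)` for a group with generators `t`: given a knapsack expression, with group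
elements represented by words over the generators, decide whether it has a solution. -/
def KPDecidable {k : ℕ} {H : Type*} [Group H] (t : Fin k → H) : Prop :=
  ComputablePred fun E : Expr (Word (Fin k)) =>
    E.IsKnapsack ∧ (E.map (wordEval t)).sol.Nonempty

/-! ### The wreath product -/

/-- The restricted wreath product `G ≀ H`, which consists of the pairs `(f, h)` where `f : H → G` has
finite support, with multiplication
`(f₁, h₁) (f₂, h₂) = (x ↦ f₁ x * f₂ (h₁⁻¹ x), h₁ h₂)`. -/
def Wreath (G H : Type*) [Group G] [Group H] : Subgroup (RegularWreathProduct G H) where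
  carrier := {x | (Function.mulSupport x.left).Finite}
  mul_mem' := by
    intro a b ha hb
    refine (ha.union (hb.image fun x => a.right * x)).subset ?_
    intro x hx
    by_contra hn
    rw [Set.mem_union, not_or] at hn
    obtain ⟨h1, h2⟩ := hn
    have e1 : a.left x = 1 := by simpa using h1
    have e2 : b.left (a.right⁻¹ * x) = 1 := by
      by_contra h
      exact h2 ⟨a.right⁻¹ * x, h, by simp⟩
    exact hx (by simp [e1, e2])
  one_mem' := by simp
  inv_mem' := by
    intro a ha
    refine (ha.image fun x => a.right⁻¹ * x).subset ?_
    intro x hx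
    refine ⟨a.right * x, ?_, by simp⟩
    intro h
    exact hx (by simp [h])

namespace Wreath

variable {G H : Type*} [Group G] [Group H]

/-- The projection `σ : G ≀ H → H`. -/
def sigma : Wreath G H →* H := RegularWreathProduct.rightHom.comp (Wreath G H).subtype

open Classical in
/-- The embedding of `G` into `G ≀ H`: the element `g` is written at the position `1`. -/
noncomputable def ofG (g : G) : Wreath G H :=
  ⟨⟨Pi.mulSingle 1 g, 1⟩,
    (Set.finite_singleton (1 : H)).subset Pi.mulSupport_mulSingle_subset⟩

/-- The embedding of `H` into `G ≀ H`. -/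
def ofH (h : H) : Wreath G H :=
  ⟨⟨1, h⟩, by
    show (Function.mulSupport (1 : H → G)).Finite
    simp⟩

/-- The generators of `G ≀ H` given by generators of `G` and of `H`. -/
noncomputable def gens {m k : ℕ} (s : Fin m → G) (t : Fin k → H) : Fin m ⊕ Fin k → Wreath G H :=
  Sum.elim (fun i => ofG (s i)) (fun j => ofH (t j))

/-- `g` belongs to the subgroup `H` of `G ≀ H`. -/
def InH (g : Wreath G H) : Prop := ∃ h : H, g = ofH h

/-- `g` belongs to the subset `GH` of `G ≀ H`. -/
def InGH (g : Wreath G H) : Prop := ∃ (a : G) (h : H), g = ofG a * ofH h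

end Wreath

/-! ### The positive hybrid intersection knapsack problem -/

/-- The data of an instance: an expression together with a finite set of loop constraints. -/
abbrev HKPData (K : Type*) := Expr K × List (ℕ × ℕ)

/-- Replace the elements (for instance words) in the data of an instance by their images. -/
def HKPData.map {K L : Type*} (f : K → L) (I : HKPData K) : HKPData L := (Expr.map f I.1, I.2)

/-- `(E, L)` is an instance of `HKP⁺`: the expression `E = α₁ ⋯ αₙ` is a knapsack expression, and each
loop constraint is a pair `(i, j)` with `0 ≤ i < j ≤ n`, so that the walk `πᵢ₊₁ ⋯ πⱼ` makes sense. -/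
def HKPData.IsInstance {K : Type*} (I : HKPData K) : Prop :=
  I.1.IsKnapsack ∧ ∀ c ∈ I.2, c.1 < c.2 ∧ c.2 ≤ I.1.length

section HKP

variable {G H : Type*} [Group G] [Group H]

/-- The solutions of an `HKP⁺(G ≀ H)`-instance `(E, L)`: the valuations `ν` with `ν (E) = 1` for which
`σ (πᵢ₊₁ ⋯ πⱼ)` is a loop in `H` for all `(i, j) ∈ L`. -/
def HKPData.sol (I : HKPData (Wreath G H)) : Set (ℕ → ℕ) :=
  {ν | I.1.eval ν = 1 ∧
    ∀ c ∈ I.2, IsLoop ((I.1.segment ν c.1 c.2).map Wreath.sigma)}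

/-- For every power, `σ` of its base is trivial or has infinite order. -/
def Expr.IsTorsionFree (E : Expr (Wreath G H)) : Prop :=
  ∀ a ∈ E, a.2.isSome → Wreath.sigma a.1 = 1 ∨ ¬ IsOfFinOrder (Wreath.sigma a.1)

/-- `E = α₁ ⋯ αₙ αₙ₊₁` is in `GH`-form: the last atom is a constant of `G ≀ H`, the base of every
power lies in `GH` or is mapped to `1` by `σ`, and every constant other than `αₙ₊₁` lies in `H`. -/
def Expr.IsGHForm (E : Expr (Wreath G H)) : Prop :=
  ∃ (E' : Expr (Wreath G H)) (g : Wreath G H), E = E' ++ [(g, none)] ∧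
    (∀ a ∈ E', a.2.isSome → Wreath.sigma a.1 = 1 ∨ Wreath.InGH a.1) ∧
    (∀ a ∈ E', a.2 = none → Wreath.InH a.1)

/-- `E` is c-simplified: any two powers whose bases lie outside `H` and have commensurable images
under `σ` have the same image under `σ`. -/
def Expr.IsCSimplified (E : Expr (Wreath G H)) : Prop :=
  ∀ a ∈ E, ∀ b ∈ E, a.2.isSome → b.2.isSome → ¬ Wreath.InH a.1 → ¬ Wreath.InH b.1 →
    Commensurable (Wreath.sigma a.1) (Wreath.sigma b.1) → Wreath.sigma a.1 = Wreath.sigma b.1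

/-- Normalized: torsion-free, in `GH`-form and c-simplified. -/
def Expr.IsNormalized (E : Expr (Wreath G H)) : Prop :=
  E.IsTorsionFree ∧ E.IsGHForm ∧ E.IsCSimplified

end HKP

end WreathKnapsack

namespace WreathKnapsack

/-! ### Expressions without variable names -/

/-- A knapsack expression without variable names (the flag marks powers), with loop constraints. -/
abbrev Gadget (W : Type*) := List (W × Bool) × List (ℕ × ℕ)

section Semantics

variable {W K H : Type*} [Group K] [Group H] (ev : W → K) (σ : K →* H)

/-- `x` is a possible value of the atom `a`. -/
def IsAtomValue (x : K) (a : W × Bool) : Prop := ∃ n : ℕ, x = ev a.1 ^ n ∧ (a.2 = false → n = 1)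

/-- All loop constraints hold for the atom values `vs`. -/
def LoopsHold (vs : List K) (L : List (ℕ × ℕ)) : Prop :=
  ∀ c ∈ L, σ (vs.take c.1).prod = σ (vs.take c.2).prod

/-- `x` is a possible value of the gadget `I`. -/
def IsValue (I : Gadget W) (x : K) : Prop :=
  ∃ vs : List K, List.Forall₂ (IsAtomValue ev) vs I.1 ∧ vs.prod = x ∧ LoopsHold σ vs I.2

end Semantics

/-- New position of a boundary after replacing a segment of length `b` at position `a` by one of
length `c`. -/
def remap (a b c i : ℕ) : ℕ := if i ≤ a then i else i - b + c

/-- Replace the segment `s` of `p ++ s ++ q` by the gadget `γ`. -/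
def plug {W : Type*} (p s q : List (W × Bool)) (L : List (ℕ × ℕ)) (γ : Gadget W) : Gadget W :=
  (p ++ γ.1 ++ q,
    L.map (fun c => (remap p.length s.length γ.1.length c.1,
      remap p.length s.length γ.1.length c.2)) ++
    γ.2.map (fun c => (p.length + c.1, p.length + c.2)))

/-- No loop constraint begins or ends inside of the segment of length `b` at position `a`. -/
def Respects (a b : ℕ) (L : List (ℕ × ℕ)) : Prop :=
  ∀ c ∈ L, (c.1 ≤ a ∨ a + b ≤ c.1) ∧ (c.2 ≤ a ∨ a + b ≤ c.2)

/-- All loop constraints are of the form `(i, j)` with `i < j ≤ n`. -/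
def ValidLoops (n : ℕ) (L : List (ℕ × ℕ)) : Prop := ∀ c ∈ L, c.1 < c.2 ∧ c.2 ≤ n

theorem respects_of_length_le_one {a b : ℕ} (h : b ≤ 1) (L : List (ℕ × ℕ)) : Respects a b L := by
  intro c _
  omega

theorem prod_take_remap {K : Type*} [Group K] (vp vs ws vq : List K) (h : ws.prod = vs.prod)
    {i : ℕ} (hi : i ≤ vp.length ∨ vp.length + vs.length ≤ i) :
    ((vp ++ ws ++ vq).take (remap vp.length vs.length ws.length i)).prod =
      ((vp ++ vs ++ vq).take i).prod := by
  unfold remap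
  split_ifs with h1
  · rw [List.append_assoc, List.append_assoc, List.take_append_of_le_length h1,
      List.take_append_of_le_length h1]
  · have h2 : vp.length + vs.length ≤ i := by omega
    obtain ⟨j, rfl⟩ := Nat.exists_eq_add_of_le h2
    have e1 : vp.length + vs.length + j - vs.length + ws.length = (vp ++ ws).length + j := by
      simp; omega
    have e2 : vp.length + vs.length + j = (vp ++ vs).length + j := by simp
    rw [e1, e2, List.take_length_add_append, List.take_length_add_append]
    simp [h]

theorem prod_take_inner {K : Type*} [Group K] (vp ws vq : List K) {i : ℕ} (hi : i ≤ ws.length) :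
    ((vp ++ ws ++ vq).take (vp.length + i)).prod = vp.prod * (ws.take i).prod := by
  rw [List.append_assoc, List.take_length_add_append, List.take_append_of_le_length hi]
  simp

theorem validLoops_plug {W : Type*} {p s q : List (W × Bool)} {L : List (ℕ × ℕ)} {γ : Gadget W}
    (hL : Respects p.length s.length L) (hv : ValidLoops (p ++ s ++ q).length L)
    (hγ : ValidLoops γ.1.length γ.2) (hne : γ.1 ≠ []) :
    ValidLoops (plug p s q L γ).1.length (plug p s q L γ).2 := by
  have hpos : 0 < γ.1.length := List.length_pos_iff.2 hne
  intro c hc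
  simp only [plug, List.mem_append, List.mem_map] at hc
  simp only [plug, List.length_append]
  rcases hc with ⟨d, hd, rfl⟩ | ⟨d, hd, rfl⟩
  · have h1 := hL d hd
    have h2 := hv d hd
    simp only [List.length_append] at h2
    simp only [remap]
    split_ifs <;> omega
  · have h2 := hγ d hd
    simp only
    omega

section Replace

variable {W K H : Type*} [Group K] [Group H] {ev : W → K} {σ : K →* H}

theorem loopsHold_plug {vp vs ws vq : List K} {p s q : List (W × Bool)} {L : List (ℕ × ℕ)}
    {γ : Gadget W} (hL : Respects p.length s.length L) (hγ : ValidLoops γ.1.length γ.2)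
    (hp : vp.length = p.length) (hs : vs.length = s.length) (hw : ws.length = γ.1.length)
    (h : ws.prod = vs.prod) :
    LoopsHold σ (vp ++ ws ++ vq) (plug p s q L γ).2 ↔
      LoopsHold σ (vp ++ vs ++ vq) L ∧ LoopsHold σ ws γ.2 := by
  simp only [LoopsHold, plug, List.mem_append, List.mem_map, or_imp, forall_and,
    forall_exists_index, and_imp, forall_apply_eq_imp_iff₂]
  refine and_congr (forall₂_congr fun c hc => ?_) (forall₂_congr fun c hc => ?_)
  · have := hL c hc
    rw [← hp, ← hs, ← hw, prod_take_remap _ _ _ _ h (by omega), prod_take_remap _ _ _ _ h (by omega)]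
  · have := hγ c hc
    rw [← hp, prod_take_inner _ _ _ (by omega), prod_take_inner _ _ _ (by omega)]
    simp

theorem forall₂_append_right {α β : Type*} {R : α → β → Prop} {l : List α} {u v : List β} :
    List.Forall₂ R l (u ++ v) ↔
      ∃ a b, l = a ++ b ∧ List.Forall₂ R a u ∧ List.Forall₂ R b v := by
  constructor
  · intro h
    refine ⟨l.take u.length, l.drop u.length, (List.take_append_drop _ _).symm, ?_, ?_⟩
    · simpa using List.forall₂_take u.length h
    · simpa using List.forall₂_drop u.length h
  · rintro ⟨a, b, rfl, h1, h2⟩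
    exact List.rel_append h1 h2

/-- Replacing a segment by a finite set of gadgets with the same values. -/
theorem isValue_plug_iff {p s q : List (W × Bool)} {L : List (ℕ × ℕ)} {γs : List (Gadget W)}
    (hL : Respects p.length s.length L) (hγ : ∀ γ ∈ γs, ValidLoops γ.1.length γ.2)
    (h : ∀ x, IsValue ev σ (s, []) x ↔ ∃ γ ∈ γs, IsValue ev σ γ x) (x : K) :
    IsValue ev σ (p ++ s ++ q, L) x ↔ ∃ γ ∈ γs, IsValue ev σ (plug p s q L γ) x := by
  constructor
  · rintro ⟨vs, h1, rfl, h2⟩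
    obtain ⟨_, vq, rfl, h3, h4⟩ := forall₂_append_right.1 h1
    obtain ⟨vp, vs, rfl, h5, h6⟩ := forall₂_append_right.1 h3
    obtain ⟨γ, hγ', ws, h7, h8, h9⟩ := (h vs.prod).1 ⟨vs, h6, rfl, by simp [LoopsHold]⟩
    refine ⟨γ, hγ', vp ++ ws ++ vq, List.rel_append (List.rel_append h5 h7) h4, by simp [h8], ?_⟩
    exact (loopsHold_plug hL (hγ γ hγ') h5.length_eq h6.length_eq h7.length_eq h8).2 ⟨h2, h9⟩
  · rintro ⟨γ, hγ', vs, h1, rfl, h2⟩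
    obtain ⟨_, vq, rfl, h3, h4⟩ := forall₂_append_right.1 (show List.Forall₂ _ _ ((p ++ γ.1) ++ q) from h1)
    obtain ⟨vp, ws, rfl, h5, h7⟩ := forall₂_append_right.1 h3
    have key : LoopsHold σ ws γ.2 := by
      intro c hc
      have := h2 (p.length + c.1, p.length + c.2) (by simp only [plug, List.mem_append, List.mem_map]; exact Or.inr ⟨c, hc, rfl⟩)
      have hv := hγ γ hγ' c hc
      have hw := h7.length_eq
      simp only at this
      rw [← h5.length_eq, prod_take_inner _ _ _ (by omega), prod_take_inner _ _ _ (by omega)] at this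
      simpa using this
    obtain ⟨vs, h6, h8, -⟩ := (h ws.prod).2 ⟨γ, hγ', ws, h7, rfl, key⟩
    refine ⟨vp ++ vs ++ vq, List.rel_append (List.rel_append h5 h6) h4, by simp [h8], ?_⟩
    exact ((loopsHold_plug hL (hγ γ hγ') h5.length_eq h6.length_eq h7.length_eq h8.symm).1 h2).1

end Replace

/-! ### Naming and forgetting variables -/

/-- Forget the names of the variables. -/
def forget {W : Type*} (E : Expr W) : List (W × Bool) := List.map (fun a => (a.1, a.2.isSome)) E

/-- Name the variables in such a way that every variable occurs once. -/
def name {W : Type*} (E : List (W × Bool)) : Expr W :=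
  E.foldr (fun a F => (a.1, if a.2 then some F.length else none) :: F) []

theorem name_cons {W : Type*} (a : W × Bool) (E : List (W × Bool)) :
    name (a :: E) = (a.1, if a.2 then some (name E).length else none) :: name E := rfl

theorem length_name {W : Type*} (E : List (W × Bool)) : (name E).length = E.length := by
  induction E with
  | nil => rfl
  | cons a E ih => simp [name_cons, ih]

theorem forget_name {W : Type*} (E : List (W × Bool)) : forget (name E) = E := by
  induction E with
  | nil => rfl
  | cons a E ih =>
    obtain ⟨w, b⟩ := a
    rw [name_cons, forget, List.map_cons]
    unfold forget at ih
    rw [ih]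
    cases b <;> simp

theorem lt_of_mem_vars_name {W : Type*} {E : List (W × Bool)} :
    ∀ x ∈ (name E).vars, x < E.length := by
  induction E with
  | nil => simp [name, Expr.vars]
  | cons a E ih =>
    obtain ⟨w, b⟩ := a
    intro x hx
    rw [name_cons, length_name] at hx
    cases b
    · have := ih x (by simpa [Expr.vars] using hx)
      simp; omega
    · simp only [Expr.vars, if_true, List.filterMap_cons, List.mem_cons] at hx
      rcases hx with rfl | hx
      · simp
      · have := ih x hx
        simp; omega

theorem isKnapsack_name {W : Type*} (E : List (W × Bool)) : (name E).IsKnapsack := by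
  induction E with
  | nil => simp [name, Expr.IsKnapsack, Expr.vars]
  | cons a E ih =>
    obtain ⟨w, b⟩ := a
    rw [name_cons, length_name]
    unfold Expr.IsKnapsack at ih ⊢
    cases b
    · simpa [Expr.vars] using ih
    · have h : E.length ∉ (name E).vars := fun h => lt_irrefl _ (lt_of_mem_vars_name _ h)
      simp only [Expr.vars, if_true, List.filterMap_cons, List.nodup_cons] at ih h ⊢
      exact ⟨h, ih⟩

section Valuations

variable {W K : Type*} [Group K] (ev : W → K)

/-- The list of the values of the atoms under a valuation. -/
def atomValues (ν : ℕ → ℕ) (F : Expr W) : List K := List.map (atomEval ν) (F.map ev)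

theorem atomValues_update {F : Expr W} {x : ℕ} (hx : x ∉ F.vars) (ν : ℕ → ℕ) (n : ℕ) :
    atomValues ev (Function.update ν x n) F = atomValues ev ν F := by
  simp only [atomValues, Expr.map, List.map_map]
  refine List.map_congr_left fun a ha => ?_
  obtain ⟨w, o⟩ := a
  cases o with
  | none => rfl
  | some y =>
    have : y ≠ x := by
      rintro rfl
      exact hx (List.mem_filterMap.2 ⟨_, ha, rfl⟩)
    simp [atomEval, atomLength, Function.update_of_ne this]

theorem forall₂_forget_iff {F : Expr W} (hF : F.IsKnapsack) (vs : List K) :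
    List.Forall₂ (IsAtomValue ev) vs (forget F) ↔ ∃ ν, atomValues ev ν F = vs := by
  constructor
  · induction F generalizing vs with
    | nil =>
      intro h
      refine ⟨0, ?_⟩
      cases h
      rfl
    | cons a F ih =>
      obtain ⟨w, o⟩ := a
      intro h
      simp only [forget, List.map_cons] at h
      obtain ⟨v, vs, ⟨n, hn, hn1⟩, h2, rfl⟩ := List.forall₂_cons_right_iff.1 h
      cases o with
      | none =>
        obtain ⟨ν, hν⟩ := ih (by simpa [Expr.IsKnapsack, Expr.vars] using hF) vs h2
        refine ⟨ν, ?_⟩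
        have := hn1 rfl
        subst this
        simp [← hν, atomValues, Expr.map, atomEval, atomLength, hn]
      | some x =>
        have hF' : x ∉ Expr.vars F ∧ Expr.IsKnapsack F := by
          simpa [Expr.IsKnapsack, Expr.vars] using hF
        obtain ⟨ν, hν⟩ := ih hF'.2 vs h2
        refine ⟨Function.update ν x n, ?_⟩
        have := atomValues_update ev hF'.1 ν n
        rw [hν] at this
        simp only [atomValues, Expr.map] at this ⊢
        simp only [List.map_cons, this]
        simp [atomEval, atomLength, hn]
  · rintro ⟨ν, rfl⟩
    simp only [forget, atomValues, Expr.map, List.map_map, List.forall₂_map_left_iff,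
      List.forall₂_map_right_iff, List.forall₂_same]
    rintro ⟨w, o⟩ -
    refine ⟨atomLength ν (w, o), rfl, ?_⟩
    cases o <;> simp [atomLength]

end Valuations

/-! ### Loops in terms of prefixes -/

section Joins

variable {K : Type*}

theorem getLast?_append_tail {α : Type*} {u v : List α} {a b : α} (hu : u.getLast? = some a)
    (hv : v.head? = some a) (hb : v.getLast? = some b) : (u ++ v.tail).getLast? = some b := by
  match v with
  | [] => simp at hv
  | [c] => simp_all
  | c :: d :: v =>
    rw [List.getLast?_cons_cons] at hb
    rw [List.getLast?_append, List.tail_cons, hb]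
    rfl

/-- The walks lead from `a` to `b`, each starting where the preceding one ends. -/
def Joins (a : K) : List (List K) → K → Prop
  | [], b => a = b
  | π :: ρs, b => ∃ c, π.head? = some a ∧ π.getLast? = some c ∧ Joins c ρs b

theorem getLast?_append_flatMap_tail {u : List K} {a b : K} {ρs : List (List K)}
    (hu : u.getLast? = some a) (h : Joins a ρs b) :
    (u ++ ρs.flatMap List.tail).getLast? = some b := by
  induction ρs generalizing u a with
  | nil => simpa [← (show a = b from h)] using hu
  | cons π ρs ih =>
    obtain ⟨c, h1, h2, h3⟩ := h
    rw [List.flatMap_cons, ← List.append_assoc]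
    exact ih (getLast?_append_tail hu h1 h2) h3

theorem isLoop_map_walkConcat_iff {L : Type*} (f : K → L) {a b : K} {ρs : List (List K)}
    (h : Joins a ρs b) (hne : ρs ≠ []) :
    IsLoop ((walkConcat ρs).map f) ↔ f a = f b := by
  cases ρs with
  | nil => exact absurd rfl hne
  | cons π ρs =>
    obtain ⟨c, h1, h2, h3⟩ := h
    have h4 := getLast?_append_flatMap_tail h2 h3
    rw [IsLoop, List.head?_map, List.getLast?_map, walkConcat, List.head?_append, h1, h4]
    simp

theorem joins_drop_take {ρs : List (List K)} {P : ℕ → K}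
    (h : ∀ i (hi : i < ρs.length), ρs[i].head? = some (P i) ∧ ρs[i].getLast? = some (P (i + 1)))
    {i j : ℕ} (hij : i ≤ j) (hj : j ≤ ρs.length) :
    Joins (P i) ((ρs.take j).drop i) (P j) := by
  induction hij using Nat.decreasingInduction with
  | self => simp [Joins]
  | of_succ i hi ih =>
    rw [List.drop_eq_getElem_cons (by simp; omega), List.getElem_take]
    exact ⟨_, (h i (by omega)).1, (h i (by omega)).2, ih⟩

end Joins

section Walks

variable {K : Type*} [Group K]

theorem head?_progression (p g : K) (l : ℕ) : (progression p g l).head? = some p := by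
  simp [progression, List.head?_range]

theorem getLast?_progression (p g : K) (l : ℕ) :
    (progression p g l).getLast? = some (p * g ^ l) := by
  simp [progression, List.getLast?_range]

theorem eval_take_succ (ν : ℕ → ℕ) (E : Expr K) {i : ℕ} (hi : i < E.length) :
    Expr.eval ν (E.take (i + 1)) = Expr.eval ν (E.take i) * atomEval ν E[i] := by
  simp only [Expr.eval, List.map_take]
  rw [List.prod_take_succ _ _ (by simpa using hi), List.getElem_map]

theorem isLoop_segment_iff {L : Type*} (f : K → L) (ν : ℕ → ℕ) (E : Expr K) {i j : ℕ}
    (hij : i < j) (hj : j ≤ E.length) :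
    IsLoop ((E.segment ν i j).map f) ↔
      f (Expr.eval ν (E.take i)) = f (Expr.eval ν (E.take j)) := by
  have hlen : (E.factorizedWalk ν).length = E.length := by simp [Expr.factorizedWalk]
  have hjoin : Joins (Expr.eval ν (E.take i)) (((E.factorizedWalk ν).take j).drop i)
      (Expr.eval ν (E.take j)) := by
    refine joins_drop_take (P := fun i => Expr.eval ν (E.take i)) (fun i hi => ?_) hij.le
      (hj.trans_eq hlen.symm)
    have hi' : i < E.length := hlen ▸ hi
    rw [eval_take_succ ν E hi']
    simp [Expr.factorizedWalk, head?_progression, getLast?_progression, atomEval]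
  refine isLoop_map_walkConcat_iff f hjoin fun h => ?_
  have := congrArg List.length h
  simp at this
  omega

end Walks

/-! ### Solutions in terms of values -/

section Solutions

variable {W G H : Type*} [Group G] [Group H] (ev : W → Wreath G H)

theorem nonempty_hkpSol_iff {F : Expr W} {L : List (ℕ × ℕ)} (hF : F.IsKnapsack)
    (hL : ValidLoops F.length L) :
    (HKPData.map ev (F, L)).sol.Nonempty ↔ IsValue ev Wreath.sigma (forget F, L) 1 := by
  have key : ∀ ν, ν ∈ (HKPData.map ev (F, L)).sol ↔ (atomValues ev ν F).prod = 1 ∧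
      LoopsHold Wreath.sigma (atomValues ev ν F) L := by
    intro ν
    refine and_congr Iff.rfl (forall₂_congr fun c hc => ?_)
    have := hL c hc
    rw [HKPData.map, isLoop_segment_iff _ _ _ this.1 (by simpa [Expr.map] using this.2)]
    simp [Expr.eval, atomValues, List.map_take]
  simp only [Set.Nonempty, key, IsValue, forall₂_forget_iff ev hF]
  constructor
  · rintro ⟨ν, h1, h2⟩
    exact ⟨_, ⟨ν, rfl⟩, h1, h2⟩
  · rintro ⟨_, ⟨ν, rfl⟩, h1, h2⟩
    exact ⟨ν, h1, h2⟩

theorem nonempty_sol_iff {E : Expr W} (hE : E.IsKnapsack) :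
    (E.map ev).sol.Nonempty ↔ IsValue ev Wreath.sigma (forget E, []) 1 := by
  rw [← nonempty_hkpSol_iff ev hE (by simp [ValidLoops])]
  simp [HKPData.sol, HKPData.map, Expr.sol]

end Solutions

/-! ### Calculations with words -/

/-- The formal inverse of a word. -/
def wordInv {α : Type} (w : Word α) : Word α := (w.map fun l => (l.1, !l.2)).reverse

/-- The `n`-th power of a word. -/
def wordPow {α : Type} (w : Word α) (n : ℕ) : Word α := (List.range n).flatMap fun _ => w

section WordEval

variable {α : Type} {K : Type*} [Group K] (gen : α → K)

@[simp] theorem wordEval_nil : wordEval gen [] = 1 := rfl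

theorem wordEval_cons (l : α × Bool) (w : Word α) :
    wordEval gen (l :: w) = wordEval gen [l] * wordEval gen w := by
  simp [wordEval]

@[simp] theorem wordEval_append (u v : Word α) :
    wordEval gen (u ++ v) = wordEval gen u * wordEval gen v := by
  simp [wordEval]

@[simp] theorem wordEval_wordInv (w : Word α) : wordEval gen (wordInv w) = (wordEval gen w)⁻¹ := by
  induction w with
  | nil => simp [wordInv]
  | cons l w ih =>
    have : wordInv (l :: w) = wordInv w ++ [(l.1, !l.2)] := by simp [wordInv]
    rw [this, wordEval_append, ih, wordEval_cons _ l, mul_inv_rev]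
    obtain ⟨a, b⟩ := l
    cases b <;> simp [wordEval]

theorem wordPow_zero (w : Word α) : wordPow w 0 = [] := rfl

theorem wordPow_succ (w : Word α) (n : ℕ) : wordPow w (n + 1) = wordPow w n ++ w := by
  simp [wordPow, List.range_succ]

@[simp] theorem wordEval_wordPow (w : Word α) (n : ℕ) :
    wordEval gen (wordPow w n) = wordEval gen w ^ n := by
  induction n with
  | zero => simp [wordPow_zero]
  | succ n ih => simp [wordPow_succ, ih, pow_succ]

theorem exists_wordEval_eq (h : Subgroup.closure (Set.range gen) = ⊤) (g : K) :
    ∃ w, wordEval gen w = g := by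
  have hg : g ∈ Subgroup.closure (Set.range gen) := h ▸ Subgroup.mem_top g
  induction hg using Subgroup.closure_induction with
  | mem x hx =>
    obtain ⟨a, rfl⟩ := hx
    exact ⟨[(a, true)], by simp [wordEval]⟩
  | one => exact ⟨[], rfl⟩
  | mul x y _ _ hx hy =>
    obtain ⟨u, rfl⟩ := hx
    obtain ⟨v, rfl⟩ := hy
    exact ⟨u ++ v, wordEval_append gen u v⟩
  | inv x _ hx =>
    obtain ⟨u, rfl⟩ := hx
    exact ⟨wordInv u, wordEval_wordInv gen u⟩

end WordEval

/-! ### The wreath product -/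

namespace Wreath

variable {G H : Type*} [Group G] [Group H]

theorem ext_iff' {x y : Wreath G H} :
    x = y ↔ (∀ p, x.1.left p = y.1.left p) ∧ sigma x = sigma y := by
  rw [Subtype.ext_iff, RegularWreathProduct.ext_iff, funext_iff]
  rfl

@[simp] theorem sigma_ofH (h : H) : sigma (ofH h : Wreath G H) = h := rfl

@[simp] theorem sigma_ofG (g : G) : sigma (ofG g : Wreath G H) = 1 := rfl

theorem ofH_mul (x y : H) : (ofH (x * y) : Wreath G H) = ofH x * ofH y := by
  rw [ext_iff']
  exact ⟨fun p => by simp [ofH], rfl⟩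

theorem ofH_one : (ofH 1 : Wreath G H) = 1 := rfl

theorem ofH_inv (x : H) : (ofH x⁻¹ : Wreath G H) = (ofH x)⁻¹ := by
  rw [eq_inv_iff_mul_eq_one, ← ofH_mul, inv_mul_cancel, ofH_one]

theorem ofG_mul (x y : G) : (ofG (x * y) : Wreath G H) = ofG x * ofG y := by
  classical
  rw [ext_iff']
  refine ⟨fun p => ?_, by simp⟩
  by_cases hp : p = 1
  · subst hp; simp [ofG]
  · simp [ofG, hp]

theorem ofG_one : (ofG 1 : Wreath G H) = 1 := by
  rw [ext_iff']
  exact ⟨fun p => by simp [ofG], rfl⟩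

theorem ofG_inv (x : G) : (ofG x⁻¹ : Wreath G H) = (ofG x)⁻¹ := by
  rw [eq_inv_iff_mul_eq_one, ← ofG_mul, inv_mul_cancel, ofG_one]

open Classical in
theorem left_conj (c : G) (z : H) :
    (ofH z * ofG c * (ofH z)⁻¹ : Wreath G H).1.left = Pi.mulSingle z c := by
  rw [← ofH_inv]
  funext p
  by_cases hp : p = z
  · subst hp; simp [ofG, ofH]
  · have : z⁻¹ * p ≠ 1 := fun h => hp (inv_mul_eq_one.1 h).symm
    simp [ofG, ofH, hp, this]

/-- Elements of `G` at different positions commute. -/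
theorem commute_conj {z z' : H} (h : z ≠ z') (c c' : G) :
    Commute (ofH z * ofG c * (ofH z)⁻¹ : Wreath G H) (ofH z' * ofG c' * (ofH z')⁻¹) := by
  classical
  have hs : ∀ (z : H) (c : G), sigma (ofH z * ofG c * (ofH z)⁻¹ : Wreath G H) = 1 := by simp
  have hs' : ∀ (z : H) (c : G), (ofH z * ofG c * (ofH z)⁻¹ : Wreath G H).1.right = 1 := hs
  have hmul : ∀ (z z' : H) (c c' : G) p,
      ((ofH z * ofG c * (ofH z)⁻¹ : Wreath G H) * (ofH z' * ofG c' * (ofH z')⁻¹)).1.left p =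
        (Pi.mulSingle z c * Pi.mulSingle z' c' : H → G) p := by
    intro z z' c c' p
    rw [Subgroup.coe_mul, RegularWreathProduct.mul_left, hs', left_conj]
    simp only [Pi.mul_apply, left_conj, inv_one, one_mul]
  refine ext_iff'.2 ⟨fun p => ?_, by simp only [map_mul, hs]⟩
  rw [hmul, hmul]
  have hc : Commute (Pi.mulSingle z c : H → G) (Pi.mulSingle z' c') := Pi.mulSingle_commute h _ _
  exact congrFun hc.eq p

end Wreath

/-- A word over the generators of `G` as a word over the generators of `G ≀ H`. -/
def embG {m k : ℕ} (w : Word (Fin m)) : Word (Fin m ⊕ Fin k) := w.map fun l => (Sum.inl l.1, l.2)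

/-- A word over the generators of `H` as a word over the generators of `G ≀ H`. -/
def embH {m k : ℕ} (w : Word (Fin k)) : Word (Fin m ⊕ Fin k) := w.map fun l => (Sum.inr l.1, l.2)

/-- The projection `σ` on words. -/
def sig {m k : ℕ} (w : Word (Fin m ⊕ Fin k)) : Word (Fin k) :=
  w.filterMap fun l => l.1.elim (fun _ => none) (fun j => some (j, l.2))

section WreathWords

variable {G H : Type*} [Group G] [Group H] {m k : ℕ} (s : Fin m → G) (t : Fin k → H)

@[simp] theorem wordEval_embG (w : Word (Fin m)) :
    wordEval (Wreath.gens s t) (embG w) = Wreath.ofG (wordEval s w) := by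
  induction w with
  | nil => exact Wreath.ofG_one.symm
  | cons l w ih =>
    have : (embG (l :: w) : Word (Fin m ⊕ Fin k)) = (Sum.inl l.1, l.2) :: embG w := rfl
    rw [this, wordEval_cons, ih, wordEval_cons _ l, Wreath.ofG_mul]
    obtain ⟨a, b⟩ := l
    cases b <;> simp [wordEval, Wreath.gens, Wreath.ofG_inv]

@[simp] theorem wordEval_embH (w : Word (Fin k)) :
    wordEval (Wreath.gens s t) (embH w) = Wreath.ofH (wordEval t w) := by
  induction w with
  | nil => exact Wreath.ofH_one.symm
  | cons l w ih =>
    have : (embH (l :: w) : Word (Fin m ⊕ Fin k)) = (Sum.inr l.1, l.2) :: embH w := rfl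
    rw [this, wordEval_cons, ih, wordEval_cons _ l, Wreath.ofH_mul]
    obtain ⟨a, b⟩ := l
    cases b <;> simp [wordEval, Wreath.gens, Wreath.ofH_inv]

@[simp] theorem sig_nil : sig ([] : Word (Fin m ⊕ Fin k)) = [] := rfl

@[simp] theorem sig_append (u v : Word (Fin m ⊕ Fin k)) : sig (u ++ v) = sig u ++ sig v := by
  simp [sig]

@[simp] theorem sig_embH (w : Word (Fin k)) : sig (embH w : Word (Fin m ⊕ Fin k)) = w := by
  simp [sig, embH, List.filterMap_map, Function.comp_def]

@[simp] theorem sig_embG (w : Word (Fin m)) : sig (embG w : Word (Fin m ⊕ Fin k)) = [] := by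
  simp [sig, embG]

theorem wordEval_sig (w : Word (Fin m ⊕ Fin k)) :
    wordEval t (sig w) = Wreath.sigma (wordEval (Wreath.gens s t) w) := by
  induction w with
  | nil => rfl
  | cons l w ih =>
    have : sig (l :: w) = sig [l] ++ sig w := sig_append [l] w
    rw [this, wordEval_append, ih, wordEval_cons _ l, map_mul]
    congr 1
    obtain ⟨a | a, b⟩ := l
    · have h : sig [((Sum.inl a, b) : (Fin m ⊕ Fin k) × Bool)] = [] := rfl
      cases b <;> simp [h, wordEval, Wreath.gens]
    · have h : sig [((Sum.inr a, b) : (Fin m ⊕ Fin k) × Bool)] = [(a, b)] := rfl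
      cases b <;> simp [h, wordEval, Wreath.gens]

end WreathWords

/-! ### Group identities -/

section Identities

variable {K : Type*} [Group K]

/-- Extract a factor `e` from the base of a power. -/
theorem pow_extract {f e f' h : K} (h1 : ∀ n : ℕ, Commute (h ^ n * e * (h ^ n)⁻¹) f)
    (h2 : ∀ n : ℕ, Commute (h ^ (n + 1) * e * (h ^ (n + 1))⁻¹) f') (n : ℕ) :
    (f * e * f' * h) ^ n = (e * h) ^ n * h⁻¹ ^ n * (f * f' * h) ^ n := by
  have key : ∀ n : ℕ, (f * f' * h) ^ n * f * e = h ^ n * e * (h ^ n)⁻¹ * (f * f' * h) ^ n * f := by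
    intro n
    induction n with
    | zero => simpa using (h1 0).eq.symm
    | succ n ih =>
      have e1 : h * (h ^ n * e * (h ^ n)⁻¹) = h ^ (n + 1) * e * (h ^ (n + 1))⁻¹ * h := by
        rw [pow_succ']; group
      calc (f * f' * h) ^ (n + 1) * f * e = f * f' * h * ((f * f' * h) ^ n * f * e) := by
            rw [pow_succ']; group
        _ = f * f' * (h * (h ^ n * e * (h ^ n)⁻¹)) * (f * f' * h) ^ n * f := by
            rw [ih]; group
        _ = f * (f' * (h ^ (n + 1) * e * (h ^ (n + 1))⁻¹)) * h * (f * f' * h) ^ n * f := by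
            rw [e1]; group
        _ = (f * (h ^ (n + 1) * e * (h ^ (n + 1))⁻¹)) * f' * h * (f * f' * h) ^ n * f := by
            rw [← (h2 n).eq]; group
        _ = h ^ (n + 1) * e * (h ^ (n + 1))⁻¹ * (f * f' * h) ^ (n + 1) * f := by
            rw [← (h1 (n + 1)).eq, pow_succ' (f * f' * h)]; simp only [mul_assoc]
  induction n with
  | zero => simp
  | succ n ih =>
    calc (f * e * f' * h) ^ (n + 1)
        = (e * h) ^ n * h⁻¹ ^ n * ((f * f' * h) ^ n * f * e) * f' * h := by
          rw [pow_succ, ih]; group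
      _ = (e * h) ^ n * e * h⁻¹ ^ n * ((f * f' * h) ^ n * (f * f' * h)) := by
          rw [key]; group
      _ = (e * h) ^ (n + 1) * h⁻¹ ^ (n + 1) * (f * f' * h) ^ (n + 1) := by
          rw [← pow_succ, pow_succ (e * h), pow_succ' h⁻¹]; group

/-- Replace `e` by its inverse in a power of `c * e`. -/
theorem pow_reverse {c e : K} (h : ∀ n : ℕ, Commute (e ^ (n + 1) * c * (e ^ (n + 1))⁻¹) c) (n : ℕ) :
    (c * e) ^ n = e ^ n * e⁻¹ * (c * e⁻¹) ^ n * e * e ^ n := by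
  have key : ∀ n : ℕ, (c * e) ^ n * c = e ^ n * c * (e ^ n)⁻¹ * (c * e) ^ n := by
    intro n
    induction n with
    | zero => simp
    | succ n ih =>
      have e1 : e * (e ^ n * c * (e ^ n)⁻¹) = e ^ (n + 1) * c * (e ^ (n + 1))⁻¹ * e := by
        rw [pow_succ']; group
      calc (c * e) ^ (n + 1) * c = c * e * ((c * e) ^ n * c) := by rw [pow_succ']; group
        _ = c * (e * (e ^ n * c * (e ^ n)⁻¹)) * (c * e) ^ n := by rw [ih]; group
        _ = c * (e ^ (n + 1) * c * (e ^ (n + 1))⁻¹) * e * (c * e) ^ n := by rw [e1]; group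
        _ = e ^ (n + 1) * c * (e ^ (n + 1))⁻¹ * (c * e) ^ (n + 1) := by
          rw [← (h n).eq, pow_succ' (c * e)]; simp only [mul_assoc]
  induction n with
  | zero => simp
  | succ n ih =>
    calc (c * e) ^ (n + 1) = (c * e) ^ n * c * e := by rw [pow_succ]; group
      _ = e ^ n * c * (e ^ n)⁻¹ * (c * e) ^ n * e := by rw [key]
      _ = e ^ n * c * (e ^ n)⁻¹ * (e ^ n * e⁻¹ * (c * e⁻¹) ^ n * e * e ^ n) * e := by rw [ih]
      _ = e ^ (n + 1) * e⁻¹ * (c * e⁻¹) ^ (n + 1) * e * e ^ (n + 1) := by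
          rw [pow_succ' (c * e⁻¹)]
          generalize (c * e⁻¹) ^ n = x
          group

theorem conj_pow_eq (z c e : K) (n : ℕ) :
    (z * c * z⁻¹ * e) ^ n = z * (c * (z⁻¹ * e * z)) ^ n * z⁻¹ := by
  rw [← conj_pow]
  group

end Identities

/-! ### Facts about knapsack expressions over `H` -/

/-- A knapsack expression over `H` together with an answer to the question whether it is solvable. -/
abbrev Fact (k : ℕ) := Expr (Word (Fin k)) × Bool

/-- The answer is right. -/
def Fact.IsTrue {k : ℕ} {H : Type*} [Group H] (t : Fin k → H) (x : Fact k) : Prop :=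
  x.2 = true ↔ x.1.IsKnapsack ∧ (x.1.map (wordEval t)).sol.Nonempty

/-- The fact that `w = 1`. -/
def factOne {k : ℕ} (w : Word (Fin k)) : Fact k := ([(w, none)], true)

/-- The fact that `e ^ n * z ≠ 1` for all `n`. -/
def factNe {k : ℕ} (e z : Word (Fin k)) : Fact k := ([(e, some 0), (z, none)], false)

/-- The fact that `d ^ (a + 1) * e ^ (b + 1) ≠ 1` for all `a` and `b`. -/
def factNe₂ {k : ℕ} (d e : Word (Fin k)) : Fact k :=
  ([(d, some 0), (d, none), (e, some 1), (e, none)], false)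

section Facts

variable {k : ℕ} {H : Type*} [Group H] {t : Fin k → H}

theorem isTrue_factOne {w : Word (Fin k)} : (factOne w).IsTrue t ↔ wordEval t w = 1 := by
  simp [factOne, Fact.IsTrue, Expr.IsKnapsack, Expr.vars, Expr.sol, Expr.map, Expr.eval, atomEval,
    atomLength, Set.Nonempty]

theorem atomEval_none {K : Type*} [Group K] (ν : ℕ → ℕ) (g : K) : atomEval ν (g, none) = g := by
  simp [atomEval, atomLength]

theorem atomEval_some {K : Type*} [Group K] (ν : ℕ → ℕ) (g : K) (x : ℕ) :
    atomEval ν (g, some x) = g ^ ν x := rfl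

theorem isTrue_factNe {e z : Word (Fin k)} :
    (factNe e z).IsTrue t ↔ ∀ n : ℕ, wordEval t e ^ n * wordEval t z ≠ 1 := by
  simp only [factNe, Fact.IsTrue, Expr.IsKnapsack, Expr.vars, Expr.sol, Expr.map, Expr.eval,
    List.map_cons, List.map_nil, Set.Nonempty, Set.mem_ofPred_eq, atomEval_none, atomEval_some]
  simp only [Bool.false_eq_true, false_iff, not_and, not_exists]
  constructor
  · intro h n
    simpa using h (by simp) (fun _ => n)
  · intro h _ ν
    simpa using h (ν 0)

theorem isTrue_factNe₂ {d e : Word (Fin k)} :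
    (factNe₂ d e).IsTrue t ↔
      ∀ a b : ℕ, wordEval t d ^ (a + 1) * wordEval t e ^ (b + 1) ≠ 1 := by
  simp only [factNe₂, Fact.IsTrue, Expr.IsKnapsack, Expr.vars, Expr.sol, Expr.map, Expr.eval,
    List.map_cons, List.map_nil, Set.Nonempty, Set.mem_ofPred_eq, atomEval_none, atomEval_some]
  simp only [Bool.false_eq_true, false_iff, not_and, not_exists]
  constructor
  · intro h a b
    simpa [pow_succ, mul_assoc] using h (by simp) (fun i => if i = 0 then a else b)
  · intro h _ ν
    simpa [pow_succ, mul_assoc] using h (ν 0) (ν 1)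

theorem isTrue_factNe_self {e : Word (Fin k)} :
    (factNe e e).IsTrue t ↔ ¬ IsOfFinOrder (wordEval t e) := by
  rw [isTrue_factNe, isOfFinOrder_iff_pow_eq_one]
  simp only [← pow_succ, not_exists, not_and]
  constructor
  · intro h n hn
    obtain ⟨j, rfl⟩ := Nat.exists_eq_succ_of_ne_zero hn.ne'
    exact h j
  · intro h n
    exact h (n + 1) n.succ_pos

end Facts

/-! ### Replacement rules -/

section Rules

variable {m k : ℕ}

/-- A conjugate `z * c * z⁻¹` with `z` in `H` and `c` in `G`. -/
abbrev Block (m k : ℕ) := Word (Fin k) × Word (Fin m)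

/-- The word `z * c * z⁻¹`. -/
def Block.toWord (b : Block m k) : Word (Fin m ⊕ Fin k) :=
  embH b.1 ++ embG b.2 ++ embH (wordInv b.1)

/-- The product of a list of blocks. -/
def blocksWord (B : List (Block m k)) : Word (Fin m ⊕ Fin k) := B.flatMap Block.toWord

/-- A segment, the gadgets which may replace it, and the facts which are needed for that. -/
abbrev Rule (m k : ℕ) := List (Word (Fin m ⊕ Fin k) × Bool) ×
  List (Gadget (Word (Fin m ⊕ Fin k))) × List (Fact k)

/-- Parameters of rules. -/
abbrev RuleParams (m k : ℕ) :=
  (Word (Fin m ⊕ Fin k) × Word (Fin m ⊕ Fin k) × Word (Fin m ⊕ Fin k)) ×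
    (Word (Fin k) × Word (Fin k) × Word (Fin m)) ×
    (List (Block m k) × List (Block m k)) × ℕ

/-- Split a constant. -/
def ruleSplit (u v : Word (Fin m ⊕ Fin k)) : Rule m k :=
  ([(u ++ v, false)], [([(u, false), (v, false)], [])], [])

/-- Replace a constant in `G` by a power. -/
def ruleConst (c : Word (Fin m)) (z : Word (Fin k)) : Rule m k :=
  ([(embG c, false)],
    [([(embG c ++ embH z, true), (embH (wordInv z), false)], [(0, 2)])],
    [factNe z z])

/-- Split the exponent of a power modulo `q + 1`. -/
def ruleMod (w : Word (Fin m ⊕ Fin k)) (q : ℕ) : Rule m k :=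
  ([(w, true)],
    (List.range (q + 1)).map fun r => ([(wordPow w (q + 1), true), (wordPow w r, false)], []), [])

/-- Insert a word and its inverse into the base of a power. -/
def ruleInsert (u v y : Word (Fin m ⊕ Fin k)) : Rule m k :=
  ([(u ++ v, true)], [([(u ++ (y ++ wordInv y) ++ v, true)], [])], [])

/-- Extract a block from the base of a power. -/
def ruleExtract (B₁ B₂ : List (Block m k)) (z e : Word (Fin k)) (c : Word (Fin m)) : Rule m k :=
  ([(blocksWord (B₁ ++ (z, c) :: B₂) ++ embH e, true)],
    [([(embH z, false), (embG c ++ embH (wordInv z ++ e ++ z), true), (embH (wordInv z), false),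
        (embH (wordInv e), true), (blocksWord (B₁ ++ B₂) ++ embH e, true)], [(0, 4), (3, 5)])],
    factNe e e :: (B₁.map (fun b => factNe e (z ++ wordInv b.1)) ++
      B₂.map (fun b => factNe e (e ++ z ++ wordInv b.1))))

/-- Replace `e` by its inverse in a power of `c * e`. -/
def ruleReverse (c : Word (Fin m)) (e : Word (Fin k)) : Rule m k :=
  ([(embG c ++ embH e, true)],
    [([(embH e, true), (embH (wordInv e), false), (embG c ++ embH (wordInv e), true),
        (embH e, false), (embH e, true)], [(0, 4), (1, 5)])],
    [factNe e e])

/-- Move a constant to the right of a power. -/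
def ruleSwap (w v : Word (Fin m ⊕ Fin k)) : Rule m k :=
  ([(w, false), (v, true)], [([(w ++ v ++ wordInv w, true), (w, false)], [])], [])

/-- Add a trivial constant. -/
def ruleNil : Rule m k := ([], [([([], false)], [])], [])

/-- Multiply two constants. -/
def ruleMerge (u v : Word (Fin m ⊕ Fin k)) : Rule m k :=
  ([(u, false), (v, false)], [([(u ++ v, false)], [])], [])

/-- The rules with given parameters. -/
def rules (P : RuleParams m k) : List (Rule m k) :=
  [ruleSplit P.1.1 P.1.2.1, ruleConst P.2.1.2.2 P.2.1.1, ruleMod P.1.1 P.2.2.2,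
    ruleInsert P.1.1 P.1.2.1 P.1.2.2,
    ruleExtract P.2.2.1.1 P.2.2.1.2 P.2.1.1 P.2.1.2.1 P.2.1.2.2,
    ruleReverse P.2.1.2.2 P.2.1.2.1, ruleSwap P.1.1 P.1.2.1, ruleNil, ruleMerge P.1.1 P.1.2.1]

/-- The gadgets of a rule are nonempty and their loop constraints make sense. -/
def Rule.IsValid (r : Rule m k) : Prop := ∀ γ ∈ r.2.1, γ.1 ≠ [] ∧ ValidLoops γ.1.length γ.2

theorem isValid_of_mem_rules {P : RuleParams m k} {r : Rule m k} (hr : r ∈ rules P) :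
    r.IsValid := by
  simp only [rules, List.mem_cons, List.not_mem_nil, or_false] at hr
  rcases hr with rfl | rfl | rfl | rfl | rfl | rfl | rfl | rfl | rfl <;>
    simp [Rule.IsValid, ruleSplit, ruleConst, ruleMod, ruleInsert, ruleExtract, ruleReverse,
      ruleSwap, ruleNil, ruleMerge, ValidLoops] <;>
    omega

end Rules

/-! ### Soundness of the rules -/

section Soundness

variable {m k : ℕ} {G H : Type*} [Group G] [Group H] (s : Fin m → G) (t : Fin k → H)

/-- The possible values of a gadget over `G ≀ H`. -/
abbrev GadgetValue (I : Gadget (Word (Fin m ⊕ Fin k))) (x : Wreath G H) : Prop :=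
  IsValue (wordEval (Wreath.gens s t)) Wreath.sigma I x

/-- The gadgets of a rule have together the same values as the segment which they replace. -/
def Rule.IsSound (r : Rule m k) : Prop :=
  ∀ x, GadgetValue s t (r.1, []) x ↔ ∃ γ ∈ r.2.1, GadgetValue s t γ x

variable {s t}

theorem isAtomValue_false {W K : Type*} [Group K] {ev : W → K} {x : K} {w : W} :
    IsAtomValue ev x (w, false) ↔ x = ev w := by
  constructor
  · rintro ⟨n, rfl, h⟩
    simp [h rfl]
  · rintro rfl
    exact ⟨1, by simp, fun _ => rfl⟩

theorem isAtomValue_true {W K : Type*} [Group K] {ev : W → K} {x : K} {w : W} :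
    IsAtomValue ev x (w, true) ↔ ∃ n : ℕ, x = ev w ^ n := by
  simp [IsAtomValue]

theorem isValue_nil {W K H : Type*} [Group K] [Group H] {ev : W → K} {σ : K →* H} {x : K} :
    IsValue ev σ ([], []) x ↔ x = 1 := by
  simp [IsValue, LoopsHold, eq_comm]

theorem isValue_single {W K H : Type*} [Group K] [Group H] {ev : W → K} {σ : K →* H} {x : K}
    {a : W × Bool} : IsValue ev σ ([a], []) x ↔ IsAtomValue ev x a := by
  constructor
  · rintro ⟨_, h, rfl, -⟩
    obtain ⟨v, _, h1, h2, rfl⟩ := List.forall₂_cons_right_iff.1 h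
    cases h2
    simpa using h1
  · intro h
    exact ⟨[x], List.Forall₂.cons h List.Forall₂.nil, by simp, by simp [LoopsHold]⟩

theorem isValue_pair {W K H : Type*} [Group K] [Group H] {ev : W → K} {σ : K →* H} {x : K}
    {a b : W × Bool} : IsValue ev σ ([a, b], []) x ↔
      ∃ u v, IsAtomValue ev u a ∧ IsAtomValue ev v b ∧ u * v = x := by
  constructor
  · rintro ⟨_, h, rfl, -⟩
    obtain ⟨u, _, h1, h2, rfl⟩ := List.forall₂_cons_right_iff.1 h
    obtain ⟨v, _, h3, h4, rfl⟩ := List.forall₂_cons_right_iff.1 h2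
    cases h4
    exact ⟨u, v, h1, h3, by simp⟩
  · rintro ⟨u, v, h1, h2, rfl⟩
    exact ⟨[u, v], .cons h1 (.cons h2 .nil), by simp, by simp [LoopsHold]⟩

theorem isSound_ruleSplit (u v : Word (Fin m ⊕ Fin k)) : (ruleSplit u v).IsSound s t := by
  intro x
  simp [ruleSplit, isValue_single, isValue_pair, isAtomValue_false, eq_comm]

theorem isSound_ruleMerge (u v : Word (Fin m ⊕ Fin k)) : (ruleMerge u v).IsSound s t := by
  intro x
  simp [ruleMerge, isValue_single, isValue_pair, isAtomValue_false, eq_comm]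

theorem isSound_ruleNil : (ruleNil : Rule m k).IsSound s t := by
  intro x
  simp [ruleNil, isValue_single, isValue_nil, isAtomValue_false]

theorem isSound_ruleInsert (u v y : Word (Fin m ⊕ Fin k)) : (ruleInsert u v y).IsSound s t := by
  intro x
  simp [ruleInsert, isValue_single, isAtomValue_true]

theorem isSound_ruleSwap (w v : Word (Fin m ⊕ Fin k)) : (ruleSwap w v).IsSound s t := by
  intro x
  simp only [ruleSwap, isValue_pair, isAtomValue_true, isAtomValue_false, List.mem_singleton,
    exists_eq_left, wordEval_append, wordEval_wordInv, conj_pow]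
  constructor
  · rintro ⟨_, _, rfl, ⟨n, rfl⟩, rfl⟩
    exact ⟨_, _, ⟨n, rfl⟩, rfl, by simp⟩
  · rintro ⟨_, _, ⟨n, rfl⟩, rfl, rfl⟩
    exact ⟨_, _, rfl, ⟨n, rfl⟩, by simp⟩

theorem isSound_ruleMod (w : Word (Fin m ⊕ Fin k)) (q : ℕ) : (ruleMod w q).IsSound s t := by
  intro x
  simp only [ruleMod, isValue_single, isAtomValue_true, List.mem_map, List.mem_range,
    exists_exists_and_eq_and, isValue_pair, isAtomValue_false, wordEval_wordPow]
  constructor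
  · rintro ⟨n, rfl⟩
    refine ⟨n % (q + 1), Nat.mod_lt _ q.succ_pos, _, _, ⟨n / (q + 1), rfl⟩, rfl, ?_⟩
    rw [← pow_mul, ← pow_add, Nat.div_add_mod]
  · rintro ⟨r, -, _, _, ⟨n, rfl⟩, rfl, rfl⟩
    exact ⟨(q + 1) * n + r, by rw [← pow_mul, ← pow_add]⟩

theorem isSound_ruleConst {c : Word (Fin m)} {z : Word (Fin k)}
    (h : ¬ IsOfFinOrder (wordEval t z)) : (ruleConst c z).IsSound s t := by
  intro x
  simp only [ruleConst, isValue_single, isAtomValue_false, List.mem_singleton, exists_eq_left]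
  constructor
  · rintro rfl
    refine ⟨_, .cons (isAtomValue_true.2 ⟨1, rfl⟩) (.cons (isAtomValue_false.2 rfl) .nil), ?_, ?_⟩
    · simp [Wreath.ofH_inv]
    · simp [LoopsHold]
  · rintro ⟨_, h1, rfl, h2⟩
    obtain ⟨u, _, h3, h4, rfl⟩ := List.forall₂_cons_right_iff.1 h1
    obtain ⟨v, _, h5, h6, rfl⟩ := List.forall₂_cons_right_iff.1 h4
    cases h6
    obtain ⟨n, rfl⟩ := isAtomValue_true.1 h3
    obtain rfl := isAtomValue_false.1 h5
    have h7 : wordEval t z ^ n * (wordEval t z)⁻¹ = 1 := by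
      simpa [LoopsHold, eq_comm] using h2
    have h8 : n = 1 := by
      apply injective_pow_iff_not_isOfFinOrder.2 h
      simpa using mul_inv_eq_one.1 h7
    subst h8
    simp [Wreath.ofH_inv]

theorem sigma_wordEval_blocksWord (B : List (Block m k)) :
    Wreath.sigma (wordEval (Wreath.gens s t) (blocksWord B)) = 1 := by
  induction B with
  | nil => simp [blocksWord]
  | cons b B ih =>
    unfold blocksWord at ih ⊢
    simp [Block.toWord, ih]

theorem wordEval_toWord (b : Block m k) : wordEval (Wreath.gens s t) b.toWord =
    Wreath.ofH (wordEval t b.1) * Wreath.ofG (wordEval s b.2) *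
      (Wreath.ofH (wordEval t b.1))⁻¹ := by
  simp [Block.toWord, Wreath.ofH_inv, mul_assoc]

theorem commute_blocksWord {z : H} {c : G} {B : List (Block m k)}
    (h : ∀ b ∈ B, z ≠ wordEval t b.1) :
    Commute (Wreath.ofH z * Wreath.ofG c * (Wreath.ofH z)⁻¹)
      (wordEval (Wreath.gens s t) (blocksWord B)) := by
  induction B with
  | nil => simp [blocksWord]
  | cons b B ih =>
    have e : blocksWord (b :: B) = b.toWord ++ blocksWord B := rfl
    rw [e, wordEval_append, wordEval_toWord]
    exact (Wreath.commute_conj (h b (by simp)) _ _).mul_right (ih fun b hb => h b (by simp [hb]))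

theorem ofH_pow (z : H) (n : ℕ) : (Wreath.ofH (z ^ n) : Wreath G H) = Wreath.ofH z ^ n := by
  induction n with
  | zero => simp [Wreath.ofH_one]
  | succ n ih => rw [pow_succ, Wreath.ofH_mul, ih, pow_succ]

theorem isSound_ruleExtract {B₁ B₂ : List (Block m k)} {z e : Word (Fin k)} {c : Word (Fin m)}
    (h : ∀ x ∈ (ruleExtract B₁ B₂ z e c).2.2, x.IsTrue t) :
    (ruleExtract B₁ B₂ z e c).IsSound s t := by
  have he : ¬ IsOfFinOrder (wordEval t e) := isTrue_factNe_self.1 (h _ (by simp [ruleExtract]))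
  have hinj := injective_pow_iff_not_isOfFinOrder.2 he
  have h1 : ∀ n : ℕ, ∀ b ∈ B₁, wordEval t e ^ n * wordEval t z ≠ wordEval t b.1 := by
    intro n b hb hn
    have := isTrue_factNe.1 (h (factNe e (z ++ wordInv b.1))
      (by simp only [ruleExtract]
          exact List.mem_cons_of_mem _ (List.mem_append_left _ (List.mem_map_of_mem hb)))) n
    simp [← mul_assoc, hn] at this
  have h2 : ∀ n : ℕ, ∀ b ∈ B₂, wordEval t e ^ (n + 1) * wordEval t z ≠ wordEval t b.1 := by
    intro n b hb hn
    have := isTrue_factNe.1 (h (factNe e (e ++ z ++ wordInv b.1))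
      (by simp only [ruleExtract]
          exact List.mem_cons_of_mem _ (List.mem_append_right _ (List.mem_map_of_mem hb)))) n
    rw [pow_succ] at hn
    simp [← mul_assoc, hn] at this
  have conj : ∀ n : ℕ, (Wreath.ofH (wordEval t e) : Wreath G H) ^ n *
      wordEval (Wreath.gens s t) (Block.toWord (z, c)) * (Wreath.ofH (wordEval t e) ^ n)⁻¹ =
      Wreath.ofH (wordEval t e ^ n * wordEval t z) * Wreath.ofG (wordEval s c) *
        (Wreath.ofH (wordEval t e ^ n * wordEval t z))⁻¹ := by
    intro n
    rw [wordEval_toWord, Wreath.ofH_mul, ofH_pow]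
    group
  have key := pow_extract (K := Wreath G H) (f := wordEval (Wreath.gens s t) (blocksWord B₁))
    (f' := wordEval (Wreath.gens s t) (blocksWord B₂))
    (e := wordEval (Wreath.gens s t) (Block.toWord (z, c)))
    (h := Wreath.ofH (wordEval t e))
    (fun n => by rw [conj]; exact commute_blocksWord (h1 n))
    (fun n => by rw [conj]; exact commute_blocksWord (h2 n))
  rw [wordEval_toWord] at key
  simp only [conj_pow_eq] at key
  have e1 : ∀ B : List (Block m k), ∀ b, blocksWord (B₁ ++ b :: B) =
      blocksWord B₁ ++ b.toWord ++ blocksWord B := by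
    intro B b; simp [blocksWord]
  have e2 : blocksWord (B₁ ++ B₂) = blocksWord B₁ ++ blocksWord B₂ := by simp [blocksWord]
  have key' : ∀ n : ℕ,
      wordEval (Wreath.gens s t) (blocksWord (B₁ ++ (z, c) :: B₂) ++ embH e) ^ n =
      wordEval (Wreath.gens s t) (embH z) *
      wordEval (Wreath.gens s t) (embG c ++ embH (wordInv z ++ e ++ z)) ^ n *
      wordEval (Wreath.gens s t) (embH (wordInv z)) *
      wordEval (Wreath.gens s t) (embH (wordInv e)) ^ n *
      wordEval (Wreath.gens s t) (blocksWord (B₁ ++ B₂) ++ embH e) ^ n := by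
    intro n
    have := key n
    rw [e1, e2]
    simp only [wordEval_append, wordEval_toWord, wordEval_embH, wordEval_embG, wordEval_wordInv,
      Wreath.ofH_mul, Wreath.ofH_inv]
    simpa only [mul_assoc] using this
  have conj_z : ∀ n : ℕ, ((wordEval t z)⁻¹ * wordEval t e * wordEval t z) ^ n =
      (wordEval t z)⁻¹ * wordEval t e ^ n * wordEval t z := by
    intro n
    simpa using conj_pow (i := n) (a := (wordEval t z)⁻¹) (b := wordEval t e)
  intro x
  simp only [ruleExtract, isValue_single, isAtomValue_true, List.mem_singleton, exists_eq_left]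
  constructor
  · rintro ⟨n, rfl⟩
    refine ⟨_, .cons (isAtomValue_false.2 rfl) (.cons (isAtomValue_true.2 ⟨n, rfl⟩)
      (.cons (isAtomValue_false.2 rfl) (.cons (isAtomValue_true.2 ⟨n, rfl⟩)
      (.cons (isAtomValue_true.2 ⟨n, rfl⟩) .nil)))), ?_, ?_⟩
    · rw [key' n]
      simp only [List.prod_cons, List.prod_nil, mul_one, mul_assoc]
    · simp [LoopsHold, sigma_wordEval_blocksWord, conj_z, ← mul_assoc]
  · rintro ⟨_, g1, rfl, g2⟩
    obtain ⟨u1, _, h3, g3, rfl⟩ := List.forall₂_cons_right_iff.1 g1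
    obtain ⟨u2, _, h4, g4, rfl⟩ := List.forall₂_cons_right_iff.1 g3
    obtain ⟨u3, _, h5, g5, rfl⟩ := List.forall₂_cons_right_iff.1 g4
    obtain ⟨u4, _, h6, g6, rfl⟩ := List.forall₂_cons_right_iff.1 g5
    obtain ⟨u5, _, h7, g7, rfl⟩ := List.forall₂_cons_right_iff.1 g6
    cases g7
    obtain rfl := isAtomValue_false.1 h3
    obtain ⟨n1, rfl⟩ := isAtomValue_true.1 h4
    obtain rfl := isAtomValue_false.1 h5
    obtain ⟨n2, rfl⟩ := isAtomValue_true.1 h6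
    obtain ⟨n3, rfl⟩ := isAtomValue_true.1 h7
    simp [LoopsHold, sigma_wordEval_blocksWord, conj_z, ← mul_assoc] at g2
    obtain ⟨g8, g9⟩ := g2
    obtain rfl : n1 = n2 := hinj (mul_inv_eq_one.1 g8.symm)
    obtain rfl : n1 = n3 := hinj (by simpa using g9)
    refine ⟨n1, ?_⟩
    rw [key' n1]
    simp only [List.prod_cons, List.prod_nil, mul_one, mul_assoc]

theorem isSound_ruleReverse {c : Word (Fin m)} {e : Word (Fin k)}
    (h : ¬ IsOfFinOrder (wordEval t e)) : (ruleReverse c e).IsSound s t := by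
  have hinj := injective_pow_iff_not_isOfFinOrder.2 h
  have comm : ∀ n : ℕ, Commute ((Wreath.ofH (wordEval t e) : Wreath G H) ^ (n + 1) *
      Wreath.ofG (wordEval s c) * (Wreath.ofH (wordEval t e) ^ (n + 1))⁻¹)
      (Wreath.ofG (wordEval s c)) := by
    intro n
    have hne : wordEval t e ^ (n + 1) ≠ 1 := fun hn =>
      h (isOfFinOrder_iff_pow_eq_one.2 ⟨n + 1, n.succ_pos, hn⟩)
    simpa [ofH_pow, Wreath.ofH_one] using
      Wreath.commute_conj hne (wordEval s c) (wordEval s c)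
  have key' : ∀ n : ℕ, wordEval (Wreath.gens s t) (embG c ++ embH e) ^ n =
      wordEval (Wreath.gens s t) (embH e) ^ n * wordEval (Wreath.gens s t) (embH (wordInv e)) *
      wordEval (Wreath.gens s t) (embG c ++ embH (wordInv e)) ^ n *
      wordEval (Wreath.gens s t) (embH e) * wordEval (Wreath.gens s t) (embH e) ^ n := by
    intro n
    simpa [Wreath.ofH_inv] using pow_reverse comm n
  intro x
  simp only [ruleReverse, isValue_single, isAtomValue_true, List.mem_singleton, exists_eq_left]
  constructor
  · rintro ⟨n, rfl⟩
    refine ⟨_, .cons (isAtomValue_true.2 ⟨n, rfl⟩) (.cons (isAtomValue_false.2 rfl)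
      (.cons (isAtomValue_true.2 ⟨n, rfl⟩) (.cons (isAtomValue_false.2 rfl)
      (.cons (isAtomValue_true.2 ⟨n, rfl⟩) .nil)))), ?_, ?_⟩
    · rw [key' n]
      simp only [List.prod_cons, List.prod_nil, mul_one, mul_assoc]
    · have e1 : wordEval t e ^ n * ((wordEval t e)⁻¹ * ((wordEval t e ^ n)⁻¹ * wordEval t e)) =
          1 := by group
      have e2 : (wordEval t e)⁻¹ * ((wordEval t e ^ n)⁻¹ *
          (wordEval t e * wordEval t e ^ n)) = 1 := by group
      simp [LoopsHold, e1, e2]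
  · rintro ⟨_, g1, rfl, g2⟩
    obtain ⟨u1, _, h3, g3, rfl⟩ := List.forall₂_cons_right_iff.1 g1
    obtain ⟨u2, _, h4, g4, rfl⟩ := List.forall₂_cons_right_iff.1 g3
    obtain ⟨u3, _, h5, g5, rfl⟩ := List.forall₂_cons_right_iff.1 g4
    obtain ⟨u4, _, h6, g6, rfl⟩ := List.forall₂_cons_right_iff.1 g5
    obtain ⟨u5, _, h7, g7, rfl⟩ := List.forall₂_cons_right_iff.1 g6
    cases g7
    obtain ⟨n1, rfl⟩ := isAtomValue_true.1 h3
    obtain rfl := isAtomValue_false.1 h4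
    obtain ⟨n2, rfl⟩ := isAtomValue_true.1 h5
    obtain rfl := isAtomValue_false.1 h6
    obtain ⟨n3, rfl⟩ := isAtomValue_true.1 h7
    simp [LoopsHold] at g2
    obtain ⟨g8, g9⟩ := g2
    have e2 : (wordEval t e)⁻¹ * ((wordEval t e ^ n2)⁻¹ * wordEval t e) =
        (wordEval t e ^ n2)⁻¹ := by group
    rw [e2] at g8
    obtain rfl : n1 = n2 := hinj (mul_inv_eq_one.1 g8.symm)
    have e3 : (wordEval t e)⁻¹ * ((wordEval t e ^ n1)⁻¹ * (wordEval t e * wordEval t e ^ n3)) =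
        (wordEval t e ^ n1)⁻¹ * wordEval t e ^ n3 := by group
    obtain rfl : n1 = n3 := hinj (inv_mul_eq_one.1 (e3.symm.trans g9))
    refine ⟨n1, ?_⟩
    rw [key' n1]
    simp only [List.prod_cons, List.prod_nil, mul_one, mul_assoc]

theorem isSound_of_mem_rules {P : RuleParams m k} {r : Rule m k} (hr : r ∈ rules P)
    (h : ∀ x ∈ r.2.2, x.IsTrue t) : r.IsSound s t := by
  simp only [rules, List.mem_cons, List.not_mem_nil, or_false] at hr
  rcases hr with rfl | rfl | rfl | rfl | rfl | rfl | rfl | rfl | rfl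
  · exact isSound_ruleSplit _ _
  · exact isSound_ruleConst (isTrue_factNe_self.1 (h _ (by simp [ruleConst])))
  · exact isSound_ruleMod _ _
  · exact isSound_ruleInsert _ _ _
  · exact isSound_ruleExtract h
  · exact isSound_ruleReverse (isTrue_factNe_self.1 (h _ (by simp [ruleReverse])))
  · exact isSound_ruleSwap _ _
  · exact isSound_ruleNil
  · exact isSound_ruleMerge _ _

end Soundness

/-! ### The search procedure -/

section Machine

variable {m k : ℕ}

/-- The facts in `F` show that the powers and constants in `p`, followed by a constant, form a
normalized expression. -/
def CertifiedNormal (F : Fact k → Prop) (p : List (Word (Fin m ⊕ Fin k) × Bool)) : Prop :=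
  (∀ a ∈ p, a.2 = false → a.1 = embH (sig a.1)) ∧
  (∀ a ∈ p, a.2 = true → F (factOne (sig a.1)) ∨
    (F (factNe (sig a.1) (sig a.1)) ∧ a.1.tail = embH (sig a.1.tail))) ∧
  (∀ a ∈ p, ∀ b ∈ p, a.2 = true → b.2 = true → a.1 = embH (sig a.1) ∨ b.1 = embH (sig b.1) ∨
    F (factOne (sig a.1 ++ wordInv (sig b.1))) ∨
    (F (factNe₂ (sig a.1) (sig b.1)) ∧ F (factNe₂ (sig a.1) (wordInv (sig b.1)))))

/-- A move either declares an expression to be normalized, or applies a rule. It consists of the kind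
of the move, the parts of the expression before and after the place in question, the parameters and
the number of the rule. -/
abbrev Move (m k : ℕ) := Bool × (List (Word (Fin m ⊕ Fin k) × Bool) ×
  List (Word (Fin m ⊕ Fin k) × Bool)) × RuleParams m k × ℕ

/-- The rule of a move. -/
def Move.rule (mv : Move m k) : Rule m k := (rules mv.2.2.1).getD mv.2.2.2 ruleNil

/-- The move declares rightly that `I` is normalized. -/
def Move.Finishes (T : List (Fact k)) (I : Gadget (Word (Fin m ⊕ Fin k))) (mv : Move m k) : Prop :=
  mv.1 = true ∧ I.1 = mv.2.1.1 ++ mv.2.1.2 ∧ mv.2.1.2.map Prod.snd = [false] ∧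
    CertifiedNormal (· ∈ T) mv.2.1.1 ∧ ValidLoops I.1.length I.2

/-- The rule of the move can be applied to `I`. -/
def Move.Applies (T : List (Fact k)) (I : Gadget (Word (Fin m ⊕ Fin k))) (mv : Move m k) : Prop :=
  mv.1 = false ∧ I.1 = mv.2.1.1 ++ mv.rule.1 ++ mv.2.1.2 ∧
    (mv.rule.1.length ≤ 1 ∨ I.2 = []) ∧ ∀ x ∈ mv.rule.2.2, x ∈ T

/-- The result of applying the rule of a move. -/
def Move.result (I : Gadget (Word (Fin m ⊕ Fin k))) (mv : Move m k) :
    List (Gadget (Word (Fin m ⊕ Fin k))) :=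
  mv.rule.2.1.map (plug mv.2.1.1 mv.rule.1 mv.2.1.2 I.2)

/-- The gadgets which have still to be treated, and those which are finished. -/
abbrev State (m k : ℕ) :=
  List (Gadget (Word (Fin m ⊕ Fin k))) × List (Gadget (Word (Fin m ⊕ Fin k)))

open Classical in
/-- Make a move with the first gadget which has still to be treated. -/
noncomputable def step (T : List (Fact k)) (st : State m k) (mv : Move m k) : State m k :=
  st.1.head?.elim st fun I =>
    if mv.Finishes T I then (st.1.tail, I :: st.2) else
    if mv.Applies T I then (mv.result I ++ st.1.tail, st.2) else st

/-- Make several moves. -/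
noncomputable def run (T : List (Fact k)) (st : State m k) (mvs : List (Move m k)) : State m k :=
  mvs.foldl (step T) st

end Machine

/-! ### Primitive recursiveness -/

section Primrec

variable {α β γ : Type*} [Primcodable α] [Primcodable β] [Primcodable γ]

theorem primrec_cons {f : α → β} {g : α → List β} (hf : Primrec f) (hg : Primrec g) :
    Primrec fun a => f a :: g a := Primrec.list_cons.comp hf hg

theorem primrec_append {f g : α → List β} (hf : Primrec f) (hg : Primrec g) :
    Primrec fun a => f a ++ g a := Primrec.list_append.comp hf hg

theorem primrecPred_eq {f g : α → β} (hf : Primrec f) (hg : Primrec g) :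
    PrimrecPred fun a => f a = g a := Primrec.eq.comp hf hg

theorem primrecPred_forall_mem {f : α → List β} {R : β → α → Prop} (hf : Primrec f)
    (hR : PrimrecPred fun x : β × α => R x.1 x.2) : PrimrecPred fun a => ∀ b ∈ f a, R b a :=
  (PrimrecRel.forall_mem_list (R := R) hR).comp hf Primrec.id

theorem primrecPred_mem {f : α → β} {g : α → List β} (hf : Primrec f) (hg : Primrec g) :
    PrimrecPred fun a => f a ∈ g a :=
  ((PrimrecRel.exists_mem_list (R := fun (b : β) (a : β) => b = a) Primrec.eq).comp hg hf).of_eq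
    fun a => by simp

theorem primrecPred_imp {p q : α → Prop} (hp : PrimrecPred p) (hq : PrimrecPred q) :
    PrimrecPred fun a => p a → q a :=
  (hp.not.or hq).of_eq fun a => by tauto

theorem primrec_wordInv {A : Type} [Primcodable A] {f : α → Word A} (hf : Primrec f) :
    Primrec fun a => wordInv (f a) :=
  Primrec.list_reverse.comp <| Primrec.list_map hf <| Primrec.to₂ <|
    (Primrec.fst.comp Primrec.snd).pair (Primrec.not.comp (Primrec.snd.comp Primrec.snd))

theorem primrec_wordPow {A : Type} [Primcodable A] {f : α → Word A} {n : α → ℕ} (hf : Primrec f)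
    (hn : Primrec n) : Primrec fun a => wordPow (f a) (n a) :=
  Primrec.list_flatMap (Primrec.list_range.comp hn) (hf.comp Primrec.fst).to₂

variable {m k : ℕ}

theorem primrec_embG {f : α → Word (Fin m)} (hf : Primrec f) :
    Primrec fun a => (embG (f a) : Word (Fin m ⊕ Fin k)) :=
  Primrec.list_map hf <| Primrec.to₂ <|
    (Primrec.sumInl.comp (Primrec.fst.comp Primrec.snd)).pair (Primrec.snd.comp Primrec.snd)

theorem primrec_embH {f : α → Word (Fin k)} (hf : Primrec f) :
    Primrec fun a => (embH (f a) : Word (Fin m ⊕ Fin k)) :=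
  Primrec.list_map hf <| Primrec.to₂ <|
    (Primrec.sumInr.comp (Primrec.fst.comp Primrec.snd)).pair (Primrec.snd.comp Primrec.snd)

theorem primrec_sig {f : α → Word (Fin m ⊕ Fin k)} (hf : Primrec f) :
    Primrec fun a => sig (f a) := by
  refine Primrec.listFilterMap hf ?_
  refine (Primrec.sumCasesOn (f := fun x : α × ((Fin m ⊕ Fin k) × Bool) => x.2.1)
    (g := fun _ _ => none) (h := fun x j => some (j, x.2.2)) (Primrec.fst.comp Primrec.snd)
    (Primrec.const none).to₂ ?_).of_eq ?_
  · exact Primrec.to₂ <| Primrec.option_some.comp <| Primrec.snd.pair <|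
      Primrec.snd.comp (Primrec.snd.comp Primrec.fst)
  · rintro ⟨_, ⟨_ | _, _⟩⟩ <;> rfl

theorem primrec_blocksWord {f : α → List (Block m k)} (hf : Primrec f) :
    Primrec fun a => blocksWord (f a) := by
  refine Primrec.list_flatMap hf ?_
  have h1 : Primrec fun x : α × Block m k => x.2.1 := Primrec.fst.comp Primrec.snd
  have h2 : Primrec fun x : α × Block m k => x.2.2 := Primrec.snd.comp Primrec.snd
  exact primrec_append (primrec_append (primrec_embH h1) (primrec_embG h2))
    (primrec_embH (primrec_wordInv h1))

theorem primrec_factOne {f : α → Word (Fin k)} (hf : Primrec f) :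
    Primrec fun a => factOne (f a) :=
  (primrec_cons (hf.pair (Primrec.const none)) (Primrec.const [])).pair (Primrec.const true)

theorem primrec_factNe {f g : α → Word (Fin k)} (hf : Primrec f) (hg : Primrec g) :
    Primrec fun a => factNe (f a) (g a) :=
  (primrec_cons (hf.pair (Primrec.const (some 0))) <|
    primrec_cons (hg.pair (Primrec.const none)) (Primrec.const [])).pair (Primrec.const false)

theorem primrec_factNe₂ {f g : α → Word (Fin k)} (hf : Primrec f) (hg : Primrec g) :
    Primrec fun a => factNe₂ (f a) (g a) :=
  (primrec_cons (hf.pair (Primrec.const (some 0))) <|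
    primrec_cons (hf.pair (Primrec.const none)) <|
    primrec_cons (hg.pair (Primrec.const (some 1))) <|
    primrec_cons (hg.pair (Primrec.const none)) (Primrec.const [])).pair (Primrec.const false)

theorem primrec_ruleSplit {u v : α → Word (Fin m ⊕ Fin k)} (hu : Primrec u) (hv : Primrec v) :
    Primrec fun a => ruleSplit (u a) (v a) := by
  unfold ruleSplit
  repeat' first
    | assumption
    | exact Primrec.const _
    | refine primrec_cons ?_ ?_
    | refine primrec_append ?_ ?_
    | refine Primrec.pair ?_ ?_

theorem primrec_ruleConst {c : α → Word (Fin m)} {z : α → Word (Fin k)} (hc : Primrec c)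
    (hz : Primrec z) : Primrec fun a => ruleConst (c a) (z a) := by
  unfold ruleConst
  repeat' first
    | assumption
    | exact Primrec.const _
    | refine primrec_cons ?_ ?_
    | refine primrec_append ?_ ?_
    | refine primrec_embG ?_
    | refine primrec_embH ?_
    | refine primrec_wordInv ?_
    | refine primrec_factNe ?_ ?_
    | refine Primrec.pair ?_ ?_

theorem primrec_ruleMod {w : α → Word (Fin m ⊕ Fin k)} {q : α → ℕ} (hw : Primrec w)
    (hq : Primrec q) : Primrec fun a => ruleMod (w a) (q a) := by
  unfold ruleMod
  have hq' : Primrec fun a => q a + 1 := Primrec.succ.comp hq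
  refine Primrec.pair (primrec_cons (hw.pair (Primrec.const _)) (Primrec.const _))
    (Primrec.pair (Primrec.list_map (Primrec.list_range.comp hq') ?_)
      (Primrec.const _))
  refine Primrec.pair (primrec_cons ?_ (primrec_cons ?_ (Primrec.const _))) (Primrec.const _)
  · exact (primrec_wordPow (hw.comp Primrec.fst) (hq'.comp Primrec.fst)).pair (Primrec.const _)
  · exact (primrec_wordPow (hw.comp Primrec.fst) Primrec.snd).pair (Primrec.const _)

theorem primrec_ruleInsert {u v y : α → Word (Fin m ⊕ Fin k)} (hu : Primrec u) (hv : Primrec v)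
    (hy : Primrec y) : Primrec fun a => ruleInsert (u a) (v a) (y a) := by
  unfold ruleInsert
  repeat' first
    | assumption
    | exact Primrec.const _
    | refine primrec_cons ?_ ?_
    | refine primrec_append ?_ ?_
    | refine primrec_wordInv ?_
    | refine Primrec.pair ?_ ?_

theorem primrec_ruleExtract {B₁ B₂ : α → List (Block m k)} {z e : α → Word (Fin k)}
    {c : α → Word (Fin m)} (h₁ : Primrec B₁) (h₂ : Primrec B₂) (hz : Primrec z) (he : Primrec e)
    (hc : Primrec c) : Primrec fun a => ruleExtract (B₁ a) (B₂ a) (z a) (e a) (c a) := by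
  unfold ruleExtract
  have hf₁ : Primrec fun a => (B₁ a).map fun b => factNe (e a) (z a ++ wordInv b.1) :=
    Primrec.list_map h₁ <| Primrec.to₂ <| primrec_factNe (he.comp Primrec.fst) <|
      primrec_append (hz.comp Primrec.fst) (primrec_wordInv (Primrec.fst.comp Primrec.snd))
  have hf₂ : Primrec fun a => (B₂ a).map fun b => factNe (e a) (e a ++ z a ++ wordInv b.1) :=
    Primrec.list_map h₂ <| Primrec.to₂ <| primrec_factNe (he.comp Primrec.fst) <|
      primrec_append (primrec_append (he.comp Primrec.fst) (hz.comp Primrec.fst))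
        (primrec_wordInv (Primrec.fst.comp Primrec.snd))
  repeat' first
    | assumption
    | exact Primrec.const _
    | refine primrec_cons ?_ ?_
    | refine primrec_append ?_ ?_
    | refine primrec_embG ?_
    | refine primrec_embH ?_
    | refine primrec_blocksWord ?_
    | refine primrec_wordInv ?_
    | refine primrec_factNe ?_ ?_
    | refine Primrec.pair ?_ ?_

theorem primrec_ruleReverse {c : α → Word (Fin m)} {e : α → Word (Fin k)} (hc : Primrec c)
    (he : Primrec e) : Primrec fun a => ruleReverse (c a) (e a) := by
  unfold ruleReverse
  repeat' first
    | assumption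
    | exact Primrec.const _
    | refine primrec_cons ?_ ?_
    | refine primrec_append ?_ ?_
    | refine primrec_embG ?_
    | refine primrec_embH ?_
    | refine primrec_wordInv ?_
    | refine primrec_factNe ?_ ?_
    | refine Primrec.pair ?_ ?_

theorem primrec_ruleSwap {w v : α → Word (Fin m ⊕ Fin k)} (hw : Primrec w) (hv : Primrec v) :
    Primrec fun a => ruleSwap (w a) (v a) := by
  unfold ruleSwap
  repeat' first
    | assumption
    | exact Primrec.const _
    | refine primrec_cons ?_ ?_
    | refine primrec_append ?_ ?_
    | refine primrec_wordInv ?_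
    | refine Primrec.pair ?_ ?_

theorem primrec_ruleMerge {u v : α → Word (Fin m ⊕ Fin k)} (hu : Primrec u) (hv : Primrec v) :
    Primrec fun a => ruleMerge (u a) (v a) := by
  unfold ruleMerge
  repeat' first
    | assumption
    | exact Primrec.const _
    | refine primrec_cons ?_ ?_
    | refine primrec_append ?_ ?_
    | refine Primrec.pair ?_ ?_

theorem primrec_rules : Primrec (rules : RuleParams m k → List (Rule m k)) := by
  have h1 : Primrec fun P : RuleParams m k => P.1.1 := Primrec.fst.comp Primrec.fst
  have h1' : Primrec fun P : RuleParams m k => P.1.2 := Primrec.snd.comp Primrec.fst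
  have h2 : Primrec fun P : RuleParams m k => P.1.2.1 := Primrec.fst.comp h1'
  have h3 : Primrec fun P : RuleParams m k => P.1.2.2 := Primrec.snd.comp h1'
  have h4' : Primrec fun P : RuleParams m k => P.2.1 := Primrec.fst.comp Primrec.snd
  have h4 : Primrec fun P : RuleParams m k => P.2.1.1 := Primrec.fst.comp h4'
  have h5' : Primrec fun P : RuleParams m k => P.2.1.2 := Primrec.snd.comp h4'
  have h5 : Primrec fun P : RuleParams m k => P.2.1.2.1 := Primrec.fst.comp h5'
  have h6 : Primrec fun P : RuleParams m k => P.2.1.2.2 := Primrec.snd.comp h5'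
  have h7' : Primrec fun P : RuleParams m k => P.2.2 := Primrec.snd.comp Primrec.snd
  have h7'' : Primrec fun P : RuleParams m k => P.2.2.1 := Primrec.fst.comp h7'
  have h7 : Primrec fun P : RuleParams m k => P.2.2.1.1 := Primrec.fst.comp h7''
  have h8 : Primrec fun P : RuleParams m k => P.2.2.1.2 := Primrec.snd.comp h7''
  have h9 : Primrec fun P : RuleParams m k => P.2.2.2 := Primrec.snd.comp h7'
  exact primrec_cons (primrec_ruleSplit h1 h2) <| primrec_cons (primrec_ruleConst h6 h4) <|
    primrec_cons (primrec_ruleMod h1 h9) <| primrec_cons (primrec_ruleInsert h1 h2 h3) <|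
    primrec_cons (primrec_ruleExtract h7 h8 h4 h5 h6) <| primrec_cons (primrec_ruleReverse h6 h5) <|
    primrec_cons (primrec_ruleSwap h1 h2) <| primrec_cons (Primrec.const _) <|
    primrec_cons (primrec_ruleMerge h1 h2) (Primrec.const _)

theorem primrec_rule {mv : α → Move m k} (hmv : Primrec mv) : Primrec fun a => (mv a).rule := by
  have h : Primrec fun a => (mv a).2.2 := Primrec.snd.comp (Primrec.snd.comp hmv)
  exact (Primrec.list_getD ruleNil).comp (primrec_rules.comp (Primrec.fst.comp h))
    (Primrec.snd.comp h)

theorem primrecPred_certifiedNormal {T : α → List (Fact k)}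
    {p : α → List (Word (Fin m ⊕ Fin k) × Bool)} (hT : Primrec T) (hp : Primrec p) :
    PrimrecPred fun a => CertifiedNormal (· ∈ T a) (p a) := by
  refine .and (primrecPred_forall_mem hp ?_) (.and (primrecPred_forall_mem hp ?_)
    (primrecPred_forall_mem hp ?_))
  · have hw : Primrec fun x : (Word (Fin m ⊕ Fin k) × Bool) × α => x.1.1 :=
      Primrec.fst.comp Primrec.fst
    exact primrecPred_imp (primrecPred_eq (Primrec.snd.comp Primrec.fst) (Primrec.const false))
      (primrecPred_eq hw (primrec_embH (primrec_sig hw)))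
  · have hw : Primrec fun x : (Word (Fin m ⊕ Fin k) × Bool) × α => x.1.1 :=
      Primrec.fst.comp Primrec.fst
    have ht := Primrec.list_tail.comp hw
    have hs := primrec_sig hw
    have hT' : Primrec fun x : (Word (Fin m ⊕ Fin k) × Bool) × α => T x.2 := hT.comp Primrec.snd
    exact primrecPred_imp (primrecPred_eq (Primrec.snd.comp Primrec.fst) (Primrec.const true))
      (.or (primrecPred_mem (primrec_factOne hs) hT')
        (.and (primrecPred_mem (primrec_factNe hs hs) hT')
          (primrecPred_eq ht (primrec_embH (primrec_sig ht)))))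
  · refine primrecPred_forall_mem (hp.comp Primrec.snd)
      (R := fun b (x : (Word (Fin m ⊕ Fin k) × Bool) × α) => x.1.2 = true → b.2 = true →
        x.1.1 = embH (sig x.1.1) ∨ b.1 = embH (sig b.1) ∨
        factOne (sig x.1.1 ++ wordInv (sig b.1)) ∈ T x.2 ∨
        (factNe₂ (sig x.1.1) (sig b.1) ∈ T x.2 ∧
          factNe₂ (sig x.1.1) (wordInv (sig b.1)) ∈ T x.2)) ?_
    have hx : Primrec fun y : (Word (Fin m ⊕ Fin k) × Bool) × ((Word (Fin m ⊕ Fin k) × Bool) × α) =>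
      y.2.1 := Primrec.fst.comp Primrec.snd
    have ha := Primrec.fst.comp hx
    have hb : Primrec fun y : (Word (Fin m ⊕ Fin k) × Bool) × ((Word (Fin m ⊕ Fin k) × Bool) × α) =>
      y.1.1 := Primrec.fst.comp Primrec.fst
    have hT' : Primrec fun y : (Word (Fin m ⊕ Fin k) × Bool) ×
      ((Word (Fin m ⊕ Fin k) × Bool) × α) => T y.2.2 := hT.comp (Primrec.snd.comp Primrec.snd)
    have hsa := primrec_sig ha
    have hsb := primrec_sig hb
    exact primrecPred_imp (primrecPred_eq (Primrec.snd.comp hx) (Primrec.const true))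
      (primrecPred_imp (primrecPred_eq (Primrec.snd.comp Primrec.fst) (Primrec.const true))
        (.or (primrecPred_eq ha (primrec_embH hsa)) (.or (primrecPred_eq hb (primrec_embH hsb))
          (.or (primrecPred_mem (primrec_factOne (primrec_append hsa (primrec_wordInv hsb))) hT')
            (.and (primrecPred_mem (primrec_factNe₂ hsa hsb) hT')
              (primrecPred_mem (primrec_factNe₂ hsa (primrec_wordInv hsb)) hT'))))))

theorem primrecPred_finishes {T : α → List (Fact k)} {I : α → Gadget (Word (Fin m ⊕ Fin k))}
    {mv : α → Move m k} (hT : Primrec T) (hI : Primrec I) (hmv : Primrec mv) :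
    PrimrecPred fun a => (mv a).Finishes (T a) (I a) := by
  have h1 : Primrec fun a => (mv a).2.1 := Primrec.fst.comp (Primrec.snd.comp hmv)
  have hp := Primrec.fst.comp h1
  have hq := Primrec.snd.comp h1
  refine .and (primrecPred_eq (Primrec.fst.comp hmv) (Primrec.const true))
    (.and (primrecPred_eq (Primrec.fst.comp hI) (primrec_append hp hq))
    (.and (primrecPred_eq (Primrec.list_map hq (Primrec.snd.comp Primrec.snd).to₂) (Primrec.const _))
    (.and (primrecPred_certifiedNormal hT hp) (primrecPred_forall_mem (Primrec.snd.comp hI) ?_))))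
  exact .and (Primrec.nat_lt.comp (Primrec.fst.comp Primrec.fst) (Primrec.snd.comp Primrec.fst))
    (Primrec.nat_le.comp (Primrec.snd.comp Primrec.fst)
      (Primrec.list_length.comp (Primrec.fst.comp (hI.comp Primrec.snd))))

theorem primrecPred_applies {T : α → List (Fact k)} {I : α → Gadget (Word (Fin m ⊕ Fin k))}
    {mv : α → Move m k} (hT : Primrec T) (hI : Primrec I) (hmv : Primrec mv) :
    PrimrecPred fun a => (mv a).Applies (T a) (I a) := by
  have h1 : Primrec fun a => (mv a).2.1 := Primrec.fst.comp (Primrec.snd.comp hmv)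
  have hr := primrec_rule hmv
  have hs := Primrec.fst.comp hr
  exact .and (primrecPred_eq (Primrec.fst.comp hmv) (Primrec.const false))
    (.and (primrecPred_eq (Primrec.fst.comp hI)
      (primrec_append (primrec_append (Primrec.fst.comp h1) hs) (Primrec.snd.comp h1)))
    (.and (.or (Primrec.nat_le.comp (Primrec.list_length.comp hs) (Primrec.const 1))
      (primrecPred_eq (Primrec.snd.comp hI) (Primrec.const [])))
    (primrecPred_forall_mem (Primrec.snd.comp (Primrec.snd.comp hr))
      (primrecPred_mem Primrec.fst (hT.comp Primrec.snd)))))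

theorem primrec_remap {a b c i : α → ℕ} (ha : Primrec a) (hb : Primrec b) (hc : Primrec c)
    (hi : Primrec i) : Primrec fun x => remap (a x) (b x) (c x) (i x) :=
  Primrec.ite (Primrec.nat_le.comp hi ha) hi
    (Primrec.nat_add.comp (Primrec.nat_sub.comp hi hb) hc)

theorem primrec_plug {W : Type} [Primcodable W] {p s q : α → List (W × Bool)}
    {L : α → List (ℕ × ℕ)} {γ : α → Gadget W} (hp : Primrec p) (hs : Primrec s) (hq : Primrec q)
    (hL : Primrec L) (hγ : Primrec γ) :
    Primrec fun a => plug (p a) (s a) (q a) (L a) (γ a) := by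
  have hγ1 := Primrec.fst.comp hγ
  have hlp := Primrec.list_length.comp hp
  have hls := Primrec.list_length.comp hs
  have hlγ := Primrec.list_length.comp hγ1
  refine Primrec.pair (primrec_append (primrec_append hp hγ1) hq)
    (primrec_append (Primrec.list_map hL ?_)
      (Primrec.list_map (Primrec.snd.comp hγ) ?_))
  · exact Primrec.pair
      (primrec_remap (hlp.comp Primrec.fst) (hls.comp Primrec.fst) (hlγ.comp Primrec.fst)
        (Primrec.fst.comp Primrec.snd))
      (primrec_remap (hlp.comp Primrec.fst) (hls.comp Primrec.fst) (hlγ.comp Primrec.fst)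
        (Primrec.snd.comp Primrec.snd))
  · exact Primrec.pair (Primrec.nat_add.comp (hlp.comp Primrec.fst) (Primrec.fst.comp Primrec.snd))
      (Primrec.nat_add.comp (hlp.comp Primrec.fst) (Primrec.snd.comp Primrec.snd))

theorem primrec_result {I : α → Gadget (Word (Fin m ⊕ Fin k))} {mv : α → Move m k}
    (hI : Primrec I) (hmv : Primrec mv) : Primrec fun a => (mv a).result (I a) := by
  have h1 : Primrec fun a => (mv a).2.1 := Primrec.fst.comp (Primrec.snd.comp hmv)
  have hr := primrec_rule hmv
  exact Primrec.list_map (Primrec.fst.comp (Primrec.snd.comp hr)) <| Primrec.to₂ <|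
    primrec_plug ((Primrec.fst.comp h1).comp Primrec.fst) ((Primrec.fst.comp hr).comp Primrec.fst)
      ((Primrec.snd.comp h1).comp Primrec.fst) ((Primrec.snd.comp hI).comp Primrec.fst) Primrec.snd

theorem primrec_step {T : α → List (Fact k)} {st : α → State m k} {mv : α → Move m k}
    (hT : Primrec T) (hst : Primrec st) (hmv : Primrec mv) :
    Primrec fun a => step (T a) (st a) (mv a) := by
  classical
  have h1 := Primrec.fst.comp hst
  have h2 := Primrec.snd.comp hst
  have key : Primrec₂ fun (a : α) (I : Gadget (Word (Fin m ⊕ Fin k))) =>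
      if (mv a).Finishes (T a) I then ((st a).1.tail, I :: (st a).2) else
      if (mv a).Applies (T a) I then ((mv a).result I ++ (st a).1.tail, (st a).2) else st a := by
    have hmv' : Primrec fun x : α × Gadget (Word (Fin m ⊕ Fin k)) => mv x.1 := hmv.comp Primrec.fst
    have hT' : Primrec fun x : α × Gadget (Word (Fin m ⊕ Fin k)) => T x.1 := hT.comp Primrec.fst
    have ht := Primrec.list_tail.comp (h1.comp (Primrec.fst (β := Gadget (Word (Fin m ⊕ Fin k)))))
    have hd := h2.comp (Primrec.fst (β := Gadget (Word (Fin m ⊕ Fin k))))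
    exact Primrec.ite (primrecPred_finishes hT' Primrec.snd hmv')
      (ht.pair (primrec_cons Primrec.snd hd))
      (Primrec.ite (primrecPred_applies hT' Primrec.snd hmv')
        ((primrec_append (primrec_result Primrec.snd hmv') ht).pair hd) (hst.comp Primrec.fst))
  refine (Primrec.option_casesOn (Primrec.list_head?.comp h1) hst key).of_eq fun a => ?_
  unfold step
  cases (st a).1.head? <;> rfl

theorem primrec_run {T : α → List (Fact k)} {st : α → State m k} {mvs : α → List (Move m k)}
    (hT : Primrec T) (hst : Primrec st) (hmvs : Primrec mvs) :
    Primrec fun a => run (T a) (st a) (mvs a) :=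
  Primrec.list_foldl hmvs hst <| Primrec.to₂ <| primrec_step (hT.comp Primrec.fst)
    (Primrec.fst.comp Primrec.snd) (Primrec.snd.comp Primrec.snd)

theorem primrec_name {W : Type} [Primcodable W] : Primrec (name : List (W × Bool) → Expr W) := by
  refine Primrec.list_foldr (f := fun E : List (W × Bool) => E) (g := fun _ => ([] : Expr W))
    (h := fun _ (x : (W × Bool) × Expr W) =>
      (x.1.1, if x.1.2 then some x.2.length else none) :: x.2)
    Primrec.id (Primrec.const []) ?_
  have ha : Primrec fun x : List (W × Bool) × ((W × Bool) × Expr W) => x.2.1 :=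
    Primrec.fst.comp Primrec.snd
  have hF : Primrec fun x : List (W × Bool) × ((W × Bool) × Expr W) => x.2.2 :=
    Primrec.snd.comp Primrec.snd
  exact primrec_cons ((Primrec.fst.comp ha).pair
    (Primrec.ite (primrecPred_eq (Primrec.snd.comp ha) (Primrec.const true))
      (Primrec.option_some.comp (Primrec.list_length.comp hF)) (Primrec.const none))) hF

theorem primrec_forget {W : Type} [Primcodable W] :
    Primrec (forget : Expr W → List (W × Bool)) :=
  Primrec.list_map Primrec.id <| Primrec.to₂ <| (Primrec.fst.comp Primrec.snd).pair
    (Primrec.option_isSome.comp (Primrec.snd.comp Primrec.snd))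

end Primrec

/-! ### Soundness of the search procedure -/

theorem Commensurable.exists_pow {K : Type*} [Group K] {g h : K} (hc : Commensurable g h) :
    ∃ a b : ℕ, g ^ (a + 1) * h ^ (b + 1) = 1 ∨ g ^ (a + 1) * h⁻¹ ^ (b + 1) = 1 := by
  obtain ⟨a, b, ha, hb, h1⟩ := hc
  have hpos : ∃ a b : ℤ, 0 < a ∧ b ≠ 0 ∧ g ^ a = h ^ b := by
    rcases ha.lt_or_gt with h2 | h2
    · exact ⟨-a, -b, by omega, by omega, by rw [zpow_neg, zpow_neg, h1]⟩
    · exact ⟨a, b, h2, hb, h1⟩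
  clear h1 ha hb
  obtain ⟨a, b, ha, hb, h1⟩ := hpos
  obtain ⟨i, rfl⟩ : ∃ i : ℕ, a = (i + 1 : ℕ) := ⟨a.toNat - 1, by omega⟩
  rw [zpow_natCast] at h1
  rcases hb.lt_or_gt with h2 | h2
  · obtain ⟨j, rfl⟩ : ∃ j : ℕ, b = -(j + 1 : ℕ) := ⟨(-b).toNat - 1, by omega⟩
    refine ⟨i, j, Or.inl ?_⟩
    rw [h1, zpow_neg, zpow_natCast, inv_mul_cancel]
  · obtain ⟨j, rfl⟩ : ∃ j : ℕ, b = (j + 1 : ℕ) := ⟨b.toNat - 1, by omega⟩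
    refine ⟨i, j, Or.inr ?_⟩
    rw [h1, zpow_natCast, inv_pow, mul_inv_cancel]

theorem commensurable_of_pow {K : Type*} [Group K] {g h : K} {a b : ℕ}
    (hab : g ^ (a + 1) * h ^ (b + 1) = 1) : Commensurable g h := by
  refine ⟨(a + 1 : ℕ), -(b + 1 : ℕ), by omega, by omega, ?_⟩
  rw [zpow_natCast, zpow_neg, zpow_natCast]
  exact eq_inv_of_mul_eq_one_left hab

theorem commensurable_of_pow_inv {K : Type*} [Group K] {g h : K} {a b : ℕ}
    (hab : g ^ (a + 1) * h⁻¹ ^ (b + 1) = 1) : Commensurable g h := by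
  refine ⟨(a + 1 : ℕ), (b + 1 : ℕ), by omega, by omega, ?_⟩
  rw [zpow_natCast, zpow_natCast]
  rw [inv_pow] at hab
  exact mul_inv_eq_one.1 hab

section Sound

variable {m k : ℕ} {G H : Type*} [Group G] [Group H] {s : Fin m → G} {t : Fin k → H}

theorem CertifiedNormal.mono {F F' : Fact k → Prop} (h : ∀ x, F x → F' x)
    {p : List (Word (Fin m ⊕ Fin k) × Bool)} (hp : CertifiedNormal F p) : CertifiedNormal F' p := by
  refine ⟨hp.1, fun a ha h1 => ?_, fun a ha b hb h1 h2 => ?_⟩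
  · exact (hp.2.1 a ha h1).imp (h _) (And.imp_left (h _))
  · exact (hp.2.2 a ha b hb h1 h2).imp_right (Or.imp_right (Or.imp (h _) (And.imp (h _) (h _))))

theorem inH_of_eq_embH {w : Word (Fin m ⊕ Fin k)} (h : w = embH (sig w)) :
    Wreath.InH (wordEval (Wreath.gens s t) w) :=
  ⟨wordEval t (sig w), by rw [← wordEval_embH, ← h]⟩

theorem inGH_of_tail_eq_embH {w : Word (Fin m ⊕ Fin k)} (h : w.tail = embH (sig w.tail)) :
    Wreath.InGH (wordEval (Wreath.gens s t) w) := by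
  match w with
  | [] => exact ⟨1, 1, by simp [Wreath.ofG_one, Wreath.ofH_one]⟩
  | (Sum.inl i, b) :: w =>
    have e : ((Sum.inl i, b) :: w : Word (Fin m ⊕ Fin k)) = embG [(i, b)] ++ w := rfl
    rw [List.tail_cons] at h
    refine ⟨wordEval s [(i, b)], wordEval t (sig w), ?_⟩
    rw [e, wordEval_append, wordEval_embG, ← wordEval_embH (s := s), ← h]
  | (Sum.inr i, b) :: w =>
    have e : ((Sum.inr i, b) :: w : Word (Fin m ⊕ Fin k)) = embH [(i, b)] ++ w := rfl
    rw [List.tail_cons] at h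
    refine ⟨1, wordEval t ([(i, b)] ++ sig w), ?_⟩
    rw [e, wordEval_append, wordEval_embH, wordEval_append, Wreath.ofH_mul, Wreath.ofG_one,
      one_mul, ← wordEval_embH (s := s) (t := t) (sig w), ← h]

theorem CertifiedNormal.isNormalized {p : List (Word (Fin m ⊕ Fin k) × Bool)}
    (hp : CertifiedNormal (Fact.IsTrue t) p) {F : Expr (Word (Fin m ⊕ Fin k))}
    {w : Word (Fin m ⊕ Fin k)} (hF : forget F = p ++ [(w, false)]) :
    (F.map (wordEval (Wreath.gens s t))).IsNormalized := by
  obtain ⟨F', l, rfl, h1, h2⟩ := List.map_eq_append_iff.1 hF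
  obtain ⟨⟨w', o⟩, rfl, h3⟩ := List.map_eq_singleton_iff.1 h2
  obtain ⟨rfl, ho⟩ := Prod.mk.inj h3
  obtain rfl : o = none := by simpa using ho
  have hmap : (Expr.map (wordEval (Wreath.gens s t)) (F' ++ [(w', none)])) =
      Expr.map (wordEval (Wreath.gens s t)) F' ++ [(wordEval (Wreath.gens s t) w', none)] := by
    simp [Expr.map]
  have hmem : ∀ a ∈ Expr.map (wordEval (Wreath.gens s t)) F', ∃ v,
      wordEval (Wreath.gens s t) v = a.1 ∧ (v, a.2.isSome) ∈ p := by
    intro a ha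
    obtain ⟨b, hb, rfl⟩ := List.mem_map.1 ha
    exact ⟨b.1, rfl, h1 ▸ List.mem_map.2 ⟨b, hb, rfl⟩⟩
  have hmem' : ∀ a ∈ Expr.map (wordEval (Wreath.gens s t)) (F' ++ [(w', none)]), a.2.isSome → ∃ v,
      wordEval (Wreath.gens s t) v = a.1 ∧ (v, true) ∈ p := by
    intro a ha h
    rw [hmap, List.mem_append, List.mem_singleton] at ha
    rcases ha with ha | rfl
    · rw [← h]
      exact hmem a ha
    · simp at h
  refine ⟨fun a ha h => ?_, ⟨Expr.map (wordEval (Wreath.gens s t)) F',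
    wordEval (Wreath.gens s t) w', hmap, fun a ha h => ?_, fun a ha h => ?_⟩,
    fun a ha b hb h1 h2 h3 h4 h5 => ?_⟩
  · obtain ⟨v, hv, hvp⟩ := hmem' a ha h
    rw [← hv, ← wordEval_sig]
    exact (hp.2.1 _ hvp rfl).imp isTrue_factOne.1 fun h => isTrue_factNe_self.1 h.1
  · obtain ⟨v, hv, hvp⟩ := hmem a ha
    rw [← hv, ← wordEval_sig]
    exact (hp.2.1 _ hvp h).imp isTrue_factOne.1 fun h => inGH_of_tail_eq_embH h.2
  · obtain ⟨v, hv, hvp⟩ := hmem a ha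
    rw [← hv]
    exact inH_of_eq_embH (hp.1 _ hvp (by simp [h]))
  · obtain ⟨v, hv, hvp⟩ := hmem' a ha h1
    obtain ⟨v', hv', hvp'⟩ := hmem' b hb h2
    rw [← hv, ← wordEval_sig, ← hv', ← wordEval_sig] at h5 ⊢
    rcases hp.2.2 _ hvp _ hvp' rfl rfl with h | h | h | h
    · exact absurd (hv ▸ inH_of_eq_embH h) h3
    · exact absurd (hv' ▸ inH_of_eq_embH h) h4
    · have := isTrue_factOne.1 h
      rw [wordEval_append, wordEval_wordInv] at this
      exact mul_inv_eq_one.1 this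
    · obtain ⟨i, j, h6 | h6⟩ := h5.exists_pow
      · exact absurd h6 (isTrue_factNe₂.1 h.1 i j)
      · exact absurd h6 (by simpa using isTrue_factNe₂.1 h.2 i j)

/-- The expression is normalized, and the loop constraints make sense. -/
def Gadget.IsFinal (s : Fin m → G) (t : Fin k → H) (I : Gadget (Word (Fin m ⊕ Fin k))) : Prop :=
  ValidLoops I.1.length I.2 ∧ (Expr.map (wordEval (Wreath.gens s t)) (name I.1)).IsNormalized

/-- Some gadget of the state has the value `1`. -/
def State.IsSolvable (s : Fin m → G) (t : Fin k → H) (st : State m k) : Prop :=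
  (∃ I ∈ st.1, GadgetValue s t I 1) ∨ ∃ I ∈ st.2, GadgetValue s t I 1

theorem Move.Finishes.isFinal {T : List (Fact k)} (hT : ∀ x ∈ T, x.IsTrue t)
    {I : Gadget (Word (Fin m ⊕ Fin k))} {mv : Move m k} (h : mv.Finishes T I) : I.IsFinal s t := by
  obtain ⟨-, h1, h2, h3, h4⟩ := h
  obtain ⟨⟨w, b⟩, h5, rfl⟩ := List.map_eq_singleton_iff.1 h2
  exact ⟨h4, (h3.mono hT).isNormalized (by rw [forget_name, h1, h5])⟩

theorem Move.Applies.gadgetValue_iff {T : List (Fact k)} (hT : ∀ x ∈ T, x.IsTrue t)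
    {I : Gadget (Word (Fin m ⊕ Fin k))} {mv : Move m k} (h : mv.Applies T I) :
    GadgetValue s t I 1 ↔ ∃ J ∈ mv.result I, GadgetValue s t J 1 := by
  obtain ⟨-, h1, h2, h3⟩ := h
  have hr : ∃ P, mv.rule ∈ rules P := by
    unfold Move.rule
    by_cases hlt : mv.2.2.2 < (rules mv.2.2.1).length
    · rw [List.getD_eq_getElem _ _ hlt]
      exact ⟨_, List.getElem_mem hlt⟩
    · rw [List.getD_eq_default _ _ (not_lt.1 hlt)]
      exact ⟨mv.2.2.1, by simp [rules]⟩
  obtain ⟨P, hr⟩ := hr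
  have hL : Respects mv.2.1.1.length mv.rule.1.length I.2 := by
    rcases h2 with h2 | h2
    · exact respects_of_length_le_one h2 _
    · rw [h2]
      simp [Respects]
  have := isValue_plug_iff (p := mv.2.1.1) (q := mv.2.1.2) hL
    (fun γ hγ => (isValid_of_mem_rules hr γ hγ).2)
    (isSound_of_mem_rules (s := s) hr fun x hx => hT x (h3 x hx)) 1
  rw [← h1] at this
  refine this.trans ?_
  rw [Move.result]
  simp only [List.mem_map, exists_exists_and_eq_and]

theorem step_sound {T : List (Fact k)} (hT : ∀ x ∈ T, x.IsTrue t) (st : State m k)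
    (mv : Move m k) :
    ((step T st mv).IsSolvable s t ↔ st.IsSolvable s t) ∧
      ((∀ I ∈ st.2, I.IsFinal s t) → ∀ I ∈ (step T st mv).2, I.IsFinal s t) := by
  obtain ⟨todo, fin⟩ := st
  cases todo with
  | nil => exact ⟨Iff.rfl, id⟩
  | cons I todo =>
    simp only [step, List.head?_cons, Option.elim_some, List.tail_cons]
    split_ifs with h1 h2
    · refine ⟨?_, fun h J hJ => ?_⟩
      · simp only [State.IsSolvable, List.mem_cons, exists_eq_or_imp]
        exact or_left_comm.trans or_assoc.symm
      · rcases List.mem_cons.1 hJ with rfl | hJ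
        · exact h1.isFinal hT
        · exact h J hJ
    · refine ⟨?_, id⟩
      simp only [State.IsSolvable, List.mem_cons, List.mem_append, or_and_right, exists_or,
        exists_eq_left, h2.gadgetValue_iff hT (s := s)]
    · exact ⟨Iff.rfl, id⟩

theorem run_sound {T : List (Fact k)} (hT : ∀ x ∈ T, x.IsTrue t) (st : State m k)
    (mvs : List (Move m k)) :
    ((run T st mvs).IsSolvable s t ↔ st.IsSolvable s t) ∧
      ((∀ I ∈ st.2, I.IsFinal s t) → ∀ I ∈ (run T st mvs).2, I.IsFinal s t) := by
  induction mvs generalizing st with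
  | nil => exact ⟨Iff.rfl, id⟩
  | cons mv mvs ih =>
    have h1 := step_sound (s := s) hT st mv
    have h2 := ih (step T st mv)
    exact ⟨h2.1.trans h1.1, fun h => h2.2 (h1.2 h)⟩

end Sound

/-! ### Tables of facts -/

section Table

variable {k : ℕ}

/-- The answers to the first `n` questions. -/
def factTable (χ : Expr (Word (Fin k)) → Bool) : ℕ → List (Fact k)
  | 0 => []
  | n + 1 => ((Encodable.decode n : Option (Expr (Word (Fin k)))).map fun e => (e, χ e)).toList ++
      factTable χ n

theorem mem_factTable {χ : Expr (Word (Fin k)) → Bool} {n : ℕ} {x : Fact k} :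
    x ∈ factTable χ n → x.2 = χ x.1 := by
  induction n with
  | zero => simp [factTable]
  | succ n ih =>
    rw [factTable, List.mem_append]
    rintro (h | h)
    · simp only [Option.mem_toList, Option.map_eq_some_iff] at h
      obtain ⟨e, -, rfl⟩ := h
      rfl
    · exact ih h

theorem eventually_mem_factTable {χ : Expr (Word (Fin k)) → Bool} {x : Fact k}
    (hx : x.2 = χ x.1) : ∀ᶠ n in Filter.atTop, x ∈ factTable χ n := by
  rw [Filter.eventually_atTop]
  refine ⟨Encodable.encode x.1 + 1, fun n hn => ?_⟩
  induction n, hn using Nat.le_induction with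
  | base =>
    rw [factTable, List.mem_append]
    left
    simp [← hx]
  | succ n _ ih =>
    rw [factTable, List.mem_append]
    exact Or.inr ih

theorem computable_factTable {χ : Expr (Word (Fin k)) → Bool} (hχ : Computable χ) :
    Computable (factTable χ) := by
  have h : Computable₂ fun (_ : ℕ) (x : ℕ × List (Fact k)) =>
      ((Encodable.decode x.1 : Option (Expr (Word (Fin k)))).map fun e => (e, χ e)).toList ++
        x.2 := by
    have h1 : Computable fun y : ℕ × (ℕ × List (Fact k)) =>
        (Encodable.decode y.2.1 : Option (Expr (Word (Fin k)))) :=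
      Computable.decode.comp (Computable.fst.comp Computable.snd)
    have h2 : Computable fun y : ℕ × (ℕ × List (Fact k)) =>
        (Encodable.decode y.2.1 : Option (Expr (Word (Fin k)))).map fun e => (e, χ e) :=
      Computable.option_map h1 (Computable.snd.pair (hχ.comp Computable.snd)).to₂
    exact Computable.list_append.comp (Primrec.optionToList.to_comp.comp h2)
      (Computable.snd.comp Computable.snd)
  refine (Computable.nat_rec Computable.id (Computable.const ([] : List (Fact k))) h).of_eq ?_
  intro n
  induction n with
  | zero => rfl
  | succ n ih =>
    rw [factTable, ← ih]
    rfl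

end Table

/-! ### Derivations -/

section Derivations

variable {m k : ℕ} {H : Type*} [Group H]

/-- The gadget can be transformed by the rules to final gadgets. -/
inductive Derivable (t : Fin k → H) : Gadget (Word (Fin m ⊕ Fin k)) → Prop
  | finish {p : List (Word (Fin m ⊕ Fin k) × Bool)} {w : Word (Fin m ⊕ Fin k)}
      {L : List (ℕ × ℕ)} : CertifiedNormal (Fact.IsTrue t) p →
      ValidLoops (p ++ [(w, false)]).length L → Derivable t (p ++ [(w, false)], L)
  | rule {P : RuleParams m k} {r : Rule m k} {p q : List (Word (Fin m ⊕ Fin k) × Bool)}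
      {L : List (ℕ × ℕ)} : r ∈ rules P → (r.1.length ≤ 1 ∨ L = []) →
      (∀ x ∈ r.2.2, Fact.IsTrue t x) → (∀ γ ∈ r.2.1, Derivable t (plug p r.1 q L γ)) →
      Derivable t (p ++ r.1 ++ q, L)

variable {t : Fin k → H} {T : ℕ → List (Fact k)}

theorem run_append (T : List (Fact k)) (st : State m k) (u v : List (Move m k)) :
    run T st (u ++ v) = run T (run T st u) v := List.foldl_append

/-- The moves lead to the treatment of all gadgets in `l`. -/
def Treats (T : ℕ → List (Fact k)) (l : List (Gadget (Word (Fin m ⊕ Fin k))))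
    (mvs : List (Move m k)) : Prop :=
  ∃ out, ∀ rest fin, ∀ᶠ n in Filter.atTop, run (T n) (l ++ rest, fin) mvs = (rest, out ++ fin)

theorem exists_treats_of_forall {l : List (Gadget (Word (Fin m ⊕ Fin k)))}
    (h : ∀ I ∈ l, ∃ mvs, Treats T [I] mvs) : ∃ mvs, Treats T l mvs := by
  induction l with
  | nil => exact ⟨[], [], fun _ _ => Filter.Eventually.of_forall fun _ => rfl⟩
  | cons I l ih =>
    obtain ⟨u, out₁, h1⟩ := h I (by simp)
    obtain ⟨v, out₂, h2⟩ := ih fun J hJ => h J (by simp [hJ])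
    refine ⟨u ++ v, out₂ ++ out₁, fun rest fin => ?_⟩
    filter_upwards [h1 (l ++ rest) fin, h2 rest (out₁ ++ fin)] with n h3 h4
    rw [run_append]
    simp only [List.cons_append, List.nil_append] at h3 ⊢
    rw [h3, h4, List.append_assoc]

theorem eventually_certifiedNormal (hT : ∀ x, x.IsTrue t → ∀ᶠ n in Filter.atTop, x ∈ T n)
    {p : List (Word (Fin m ⊕ Fin k) × Bool)} (h : CertifiedNormal (Fact.IsTrue t) p) :
    ∀ᶠ n in Filter.atTop, CertifiedNormal (· ∈ T n) p := by
  have hall : ∀ (R : ℕ → (Word (Fin m ⊕ Fin k) × Bool) → Prop),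
      (∀ a ∈ p, ∀ᶠ n in Filter.atTop, R n a) → ∀ᶠ n in Filter.atTop, ∀ a ∈ p, R n a :=
    fun R hR => (Filter.eventually_all_finite p.finite_toSet).2 hR
  refine (Filter.Eventually.of_forall fun _ => h.1).and ((hall _ fun a ha => ?_).and
    (hall _ fun a ha => hall _ fun b hb => ?_))
  · by_cases h2 : a.2 = true
    · rcases h.2.1 a ha h2 with h3 | h3
      · filter_upwards [hT _ h3] with n h4 _ using Or.inl h4
      · filter_upwards [hT _ h3.1] with n h4 _ using Or.inr ⟨h4, h3.2⟩
    · exact Filter.Eventually.of_forall fun _ h3 => absurd h3 h2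
  · by_cases h1 : a.2 = true
    · by_cases h2 : b.2 = true
      · rcases h.2.2 a ha b hb h1 h2 with h3 | h3 | h3 | h3
        · exact Filter.Eventually.of_forall fun _ _ _ => Or.inl h3
        · exact Filter.Eventually.of_forall fun _ _ _ => Or.inr (Or.inl h3)
        · filter_upwards [hT _ h3] with n h4 _ _ using Or.inr (Or.inr (Or.inl h4))
        · filter_upwards [hT _ h3.1, hT _ h3.2] with n h4 h5 _ _
            using Or.inr (Or.inr (Or.inr ⟨h4, h5⟩))
      · exact Filter.Eventually.of_forall fun _ _ h3 => absurd h3 h2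
    · exact Filter.Eventually.of_forall fun _ h3 => absurd h3 h1

theorem Derivable.exists_treats (hT : ∀ x, x.IsTrue t → ∀ᶠ n in Filter.atTop, x ∈ T n)
    {I : Gadget (Word (Fin m ⊕ Fin k))} (h : Derivable t I) : ∃ mvs, Treats T [I] mvs := by
  induction h with
  | @finish p w L hp hL =>
    refine ⟨[(true, (p, [(w, false)]), default, 0)], [(p ++ [(w, false)], L)], fun rest fin => ?_⟩
    filter_upwards [eventually_certifiedNormal hT hp] with n hn
    have hf : Move.Finishes (T n) (p ++ [(w, false)], L)
        (true, (p, [(w, false)]), (default : RuleParams m k), 0) := ⟨rfl, rfl, rfl, hn, hL⟩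
    simp only [run, List.foldl_cons, List.foldl_nil, step, List.cons_append, List.nil_append,
      List.head?_cons, Option.elim_some, if_pos hf, List.tail_cons]
  | @rule P r p q L hr hlen hfacts _ ih =>
    obtain ⟨i, hi, rfl⟩ := List.mem_iff_getElem.1 hr
    obtain ⟨mvs, out, h1⟩ := exists_treats_of_forall (T := T)
      (l := (rules P)[i].2.1.map (plug p (rules P)[i].1 q L))
      (by simpa only [List.forall_mem_map] using ih)
    have hrule : Move.rule (false, (p, q), P, i) = (rules P)[i] := List.getD_eq_getElem _ _ hi
    refine ⟨(false, (p, q), P, i) :: mvs, out, fun rest fin => ?_⟩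
    filter_upwards [h1 rest fin, (Filter.eventually_all_finite
      (rules P)[i].2.2.finite_toSet).2 fun x hx => hT x (hfacts x hx)] with n h2 h3
    have hf : ¬ Move.Finishes (T n) (p ++ (rules P)[i].1 ++ q, L) (false, (p, q), P, i) :=
      fun h => by simpa using h.1
    have ha : Move.Applies (T n) (p ++ (rules P)[i].1 ++ q, L) (false, (p, q), P, i) := by
      refine ⟨rfl, ?_, ?_, ?_⟩ <;> rw [hrule]
      · exact hlen
      · exact h3
    rw [run, List.foldl_cons]
    simp only [step, List.cons_append, List.nil_append,
      List.head?_cons, Option.elim_some, if_neg hf, if_pos ha, List.tail_cons]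
    rw [Move.result, hrule]
    exact h2

end Derivations

/-! ### Commensurability classes -/

/-- Up to inversion, suitable powers of finitely many elements of infinite order lie in a set of
pairwise non-commensurable elements. -/
theorem exists_commensurable_reps {K : Type*} [Group K] (l : List K)
    (hl : ∀ d ∈ l, ¬ IsOfFinOrder d) :
    ∃ U : Set K, (∀ u ∈ U, ¬ IsOfFinOrder u) ∧ (∀ u ∈ U, ∀ v ∈ U, Commensurable u v → u = v) ∧
      ∀ d ∈ l, ∃ a : ℕ, ∃ u ∈ U, d ^ (a + 1) = u ∨ d ^ (a + 1) = u⁻¹ := by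
  induction l with
  | nil => exact ⟨∅, by simp, by simp, by simp⟩
  | cons d l ih =>
    obtain ⟨U, h1, h2, h3⟩ := ih fun x hx => hl x (by simp [hx])
    by_cases hd : ∃ u ∈ U, Commensurable d u
    · obtain ⟨u, hu, hc⟩ := hd
      obtain ⟨i, j, hij⟩ := hc.exists_pow
      refine ⟨(· ^ (j + 1)) '' U, ?_, ?_, ?_⟩
      · rintro _ ⟨v, hv, rfl⟩ hfin
        exact h1 v hv ((isOfFinOrder_pow.1 hfin).resolve_right (by omega))
      · rintro _ ⟨v, hv, rfl⟩ _ ⟨w, hw, rfl⟩ ⟨a, b, ha, hb, hab⟩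
        have : v = w := by
          refine h2 v hv w hw ⟨(j + 1 : ℕ) * a, (j + 1 : ℕ) * b, by positivity, by positivity, ?_⟩
          rw [zpow_mul, zpow_mul, zpow_natCast, zpow_natCast]
          exact hab
        rw [this]
      · intro x hx
        rcases List.mem_cons.1 hx with rfl | hx
        · refine ⟨i, u ^ (j + 1), ⟨u, hu, rfl⟩, ?_⟩
          rcases hij with hij | hij
          · exact Or.inr (eq_inv_of_mul_eq_one_left hij)
          · left
            rw [inv_pow] at hij
            exact mul_inv_eq_one.1 hij
        · obtain ⟨a, v, hv, h4⟩ := h3 x hx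
          have e : (a + 1) * (j + 1) = (a * j + a + j) + 1 := by ring
          refine ⟨a * j + a + j, v ^ (j + 1), ⟨v, hv, rfl⟩, ?_⟩
          rw [← e, pow_mul, ← inv_pow]
          exact h4.imp (fun h => by rw [h]) (fun h => by rw [h])
    · have hsymm : ∀ u ∈ U, ¬ Commensurable u d := fun u hu ⟨a, b, ha, hb, hab⟩ =>
        hd ⟨u, hu, b, a, hb, ha, hab.symm⟩
      refine ⟨insert d U, ?_, ?_, ?_⟩
      · rintro u (rfl | hu)
        · exact hl u (by simp)
        · exact h1 u hu
      · rintro u (rfl | hu) v (rfl | hv) hc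
        · rfl
        · exact absurd ⟨v, hv, hc⟩ hd
        · exact absurd hc (hsymm u hu)
        · exact h2 u hu v hv hc
      · intro x hx
        rcases List.mem_cons.1 hx with rfl | hx
        · exact ⟨0, x, by simp, by simp⟩
        · obtain ⟨a, u, hu, h4⟩ := h3 x hx
          exact ⟨a, u, Set.mem_insert_of_mem _ hu, h4⟩

/-! ### Reductions -/

section Reductions

variable {m k : ℕ} {H : Type*} [Group H] {t : Fin k → H}

/-- The expression is derivable with all meaningful loop constraints. -/
def DerivableAll (t : Fin k → H) (E : List (Word (Fin m ⊕ Fin k) × Bool)) : Prop :=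
  ∀ L, ValidLoops E.length L → Derivable t (E, L)

/-- The atom `a` can be replaced by atoms with the property `Q`, as far as derivability is
concerned. -/
def Reduces (t : Fin k → H) (Q : Word (Fin m ⊕ Fin k) × Bool → Prop)
    (a : Word (Fin m ⊕ Fin k) × Bool) : Prop :=
  ∀ p q, (∀ γ, (∀ b ∈ γ, Q b) → DerivableAll t (p ++ γ ++ q)) → DerivableAll t (p ++ [a] ++ q)

variable {Q : Word (Fin m ⊕ Fin k) × Bool → Prop}

theorem Reduces.of_prop {a : Word (Fin m ⊕ Fin k) × Bool} (h : Q a) : Reduces t Q a :=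
  fun _ _ h' => h' [a] (by simpa using h)

theorem derivableAll_of_reduces {l : List (Word (Fin m ⊕ Fin k) × Bool)}
    (hl : ∀ a ∈ l, Reduces t Q a) {p q : List (Word (Fin m ⊕ Fin k) × Bool)}
    (h : ∀ γ, (∀ b ∈ γ, Q b) → DerivableAll t (p ++ γ ++ q)) : DerivableAll t (p ++ l ++ q) := by
  induction l generalizing p with
  | nil => exact h [] (by simp)
  | cons a l ih =>
    have e : p ++ a :: l ++ q = p ++ [a] ++ (l ++ q) := by simp
    rw [e]
    refine hl a (by simp) p (l ++ q) fun γ hγ => ?_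
    rw [← List.append_assoc]
    refine ih (fun b hb => hl b (by simp [hb])) fun γ' hγ' => ?_
    have := h (γ ++ γ') fun b hb => (List.mem_append.1 hb).elim (hγ b) (hγ' b)
    rwa [← List.append_assoc] at this

theorem Reduces.of_rule {P : RuleParams m k} {r : Rule m k} (hr : r ∈ rules P)
    {a : Word (Fin m ⊕ Fin k) × Bool} (ha : r.1 = [a]) (hfacts : ∀ x ∈ r.2.2, x.IsTrue t)
    (h : ∀ γ ∈ r.2.1, ∀ b ∈ γ.1, Reduces t Q b) : Reduces t Q a := by
  intro p q h' L hL
  rw [← ha] at hL ⊢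
  refine Derivable.rule hr (Or.inl (by simp [ha])) hfacts fun γ hγ => ?_
  have hv := isValid_of_mem_rules hr γ hγ
  exact derivableAll_of_reduces (h γ hγ) h' _
    (validLoops_plug (respects_of_length_le_one (by simp [ha]) L) hL hv.2 hv.1)

theorem Reduces.split {u v : Word (Fin m ⊕ Fin k)} (hu : Reduces t Q (u, false))
    (hv : Reduces t Q (v, false)) : Reduces t Q (u ++ v, false) :=
  Reduces.of_rule (P := ((u, v, []), default, default, 0)) (r := ruleSplit u v) (by simp [rules])
    rfl (by simp [ruleSplit]) (by simp [ruleSplit, hu, hv])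

theorem Reduces.const {c : Word (Fin m)} {z : Word (Fin k)} (hz : ¬ IsOfFinOrder (wordEval t z))
    (h1 : Reduces t Q (embG c ++ embH z, true)) (h2 : Reduces t Q (embH (wordInv z), false)) :
    Reduces t Q (embG c, false) :=
  Reduces.of_rule (P := (default, (z, [], c), default, 0)) (r := ruleConst c z) (by simp [rules])
    rfl (by simpa [ruleConst] using isTrue_factNe_self.2 hz) (by
      simp only [ruleConst, forall_eq, List.mem_cons, List.not_mem_nil, or_false, forall_eq_or_imp]
      exact ⟨h1, h2⟩)

theorem Reduces.mod {w : Word (Fin m ⊕ Fin k)} (q : ℕ)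
    (h1 : Reduces t Q (wordPow w (q + 1), true)) (h2 : ∀ r, Reduces t Q (wordPow w r, false)) :
    Reduces t Q (w, true) :=
  Reduces.of_rule (P := ((w, [], []), default, default, q)) (r := ruleMod w q) (by simp [rules])
    rfl (by simp [ruleMod]) (by
      intro γ hγ
      obtain ⟨r, -, rfl⟩ := List.mem_map.1 hγ
      simp only [forall_eq, List.mem_cons, List.not_mem_nil, or_false, forall_eq_or_imp]
      exact ⟨h1, h2 r⟩)

theorem Reduces.insert {u v : Word (Fin m ⊕ Fin k)} (y : Word (Fin m ⊕ Fin k))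
    (h : Reduces t Q (u ++ (y ++ wordInv y) ++ v, true)) : Reduces t Q (u ++ v, true) :=
  Reduces.of_rule (P := ((u, v, y), default, default, 0)) (r := ruleInsert u v y)
    (by simp [rules]) rfl (by simp [ruleInsert]) (by simpa [ruleInsert] using h)

theorem Reduces.extract {B₁ B₂ : List (Block m k)} {z e : Word (Fin k)} {c : Word (Fin m)}
    (he : ¬ IsOfFinOrder (wordEval t e))
    (h₁ : ∀ b ∈ B₁, ∀ n : ℕ, wordEval t e ^ n * wordEval t z ≠ wordEval t b.1)
    (h₂ : ∀ b ∈ B₂, ∀ n : ℕ, wordEval t e ^ (n + 1) * wordEval t z ≠ wordEval t b.1)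
    (hc : ∀ x, Reduces t Q (embH x, false))
    (h3 : Reduces t Q (embG c ++ embH (wordInv z ++ e ++ z), true))
    (h4 : Reduces t Q (embH (wordInv e), true))
    (h5 : Reduces t Q (blocksWord (B₁ ++ B₂) ++ embH e, true)) :
    Reduces t Q (blocksWord (B₁ ++ (z, c) :: B₂) ++ embH e, true) := by
  refine Reduces.of_rule (P := (default, (z, e, c), (B₁, B₂), 0))
    (r := ruleExtract B₁ B₂ z e c) (by simp [rules]) rfl ?_ ?_
  · intro x hx
    simp only [ruleExtract, List.mem_cons, List.mem_append, List.mem_map] at hx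
    rcases hx with rfl | ⟨b, hb, rfl⟩ | ⟨b, hb, rfl⟩
    · exact isTrue_factNe_self.2 he
    · rw [isTrue_factNe]
      intro n hn
      refine h₁ b hb n ?_
      rw [wordEval_append, wordEval_wordInv, ← mul_assoc] at hn
      exact mul_inv_eq_one.1 hn
    · rw [isTrue_factNe]
      intro n hn
      refine h₂ b hb n ?_
      rw [wordEval_append, wordEval_append, wordEval_wordInv, ← mul_assoc, ← mul_assoc] at hn
      rw [pow_succ]
      exact mul_inv_eq_one.1 hn
  · simp only [ruleExtract, forall_eq, List.mem_cons, List.not_mem_nil,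
      or_false, forall_eq_or_imp]
    exact ⟨hc _, h3, hc _, h4, h5⟩

theorem Reduces.reverse {c : Word (Fin m)} {e : Word (Fin k)} (he : ¬ IsOfFinOrder (wordEval t e))
    (hc : ∀ x, Reduces t Q (embH x, false)) (h1 : Reduces t Q (embH e, true))
    (h2 : Reduces t Q (embG c ++ embH (wordInv e), true)) :
    Reduces t Q (embG c ++ embH e, true) := by
  refine Reduces.of_rule (P := (default, ([], e, c), default, 0)) (r := ruleReverse c e)
    (by simp [rules]) rfl (by simpa [ruleReverse] using isTrue_factNe_self.2 he) ?_
  simp only [ruleReverse, forall_eq, List.mem_cons, List.not_mem_nil,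
    or_false, forall_eq_or_imp]
  exact ⟨h1, hc _, h2, hc _, h1⟩

theorem sig_wordPow (w : Word (Fin m ⊕ Fin k)) (n : ℕ) :
    sig (wordPow w n) = wordPow (sig w) n := by
  induction n with
  | zero => rfl
  | succ n ih => rw [wordPow_succ, sig_append, ih, wordPow_succ]

theorem sig_wordInv (w : Word (Fin m ⊕ Fin k)) : sig (wordInv w) = wordInv (sig w) := by
  induction w with
  | nil => rfl
  | cons l w ih =>
    have e1 : ∀ {α : Type} (l : α × Bool) (w : Word α),
        wordInv (l :: w) = wordInv w ++ [(l.1, !l.2)] := by simp [wordInv]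
    rw [e1, sig_append, ih]
    obtain ⟨i | j, b⟩ := l
    · exact List.append_nil _
    · exact (e1 (j, b) (sig w)).symm

/-! ### Powers whose base has infinite order in `H` -/

/-- The positions of the letters from `G` in a word, when starting in `g`. -/
def positions (t : Fin k → H) : H → Word (Fin m ⊕ Fin k) → List H
  | _, [] => []
  | g, (Sum.inl _, _) :: w => g :: positions t g w
  | g, (Sum.inr j, b) :: w => positions t (g * wordEval t [(j, b)]) w

theorem positions_append (g : H) (u v : Word (Fin m ⊕ Fin k)) :
    positions t g (u ++ v) = positions t g u ++ positions t (g * wordEval t (sig u)) v := by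
  induction u generalizing g with
  | nil => simp [positions]
  | cons l u ih =>
    obtain ⟨i | j, b⟩ := l
    · have e : sig ((Sum.inl i, b) :: u) = sig u := rfl
      rw [List.cons_append, positions, positions, ih, e, List.cons_append]
    · have e : sig ((Sum.inr j, b) :: u) = [(j, b)] ++ sig u := rfl
      rw [List.cons_append, positions, positions, ih, e, wordEval_append, mul_assoc]

theorem positions_embH (g : H) (x : Word (Fin k)) :
    positions t g (embH x : Word (Fin m ⊕ Fin k)) = [] := by
  induction x generalizing g with
  | nil => rfl
  | cons l x ih => exact ih _

theorem wordInv_embH (z : Word (Fin k)) :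
    wordInv (embH z : Word (Fin m ⊕ Fin k)) = embH (wordInv z) := by
  simp [wordInv, embH]

theorem wordInv_wordInv {α : Type} (z : Word α) : wordInv (wordInv z) = z := by
  simp [wordInv, Function.comp_def]

theorem embH_append (u v : Word (Fin k)) :
    (embH (u ++ v) : Word (Fin m ⊕ Fin k)) = embH u ++ embH v := by
  simp [embH]

/-- Write the base of a power as a product of blocks and an element of `H`. -/
theorem exists_blocks (w : Word (Fin m ⊕ Fin k)) (B : List (Block m k)) (z : Word (Fin k)) :
    ∃ (B' : List (Block m k)) (z' : Word (Fin k)),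
      (∀ Q, Reduces t Q (blocksWord (B ++ B') ++ embH z', true) →
        Reduces t Q (blocksWord B ++ embH z ++ w, true)) ∧
      wordEval t z' = wordEval t z * wordEval t (sig w) ∧
      ∀ b ∈ B', wordEval t b.1 ∈ positions t (wordEval t z) w ∧ b.2.length = 1 := by
  induction w generalizing B z with
  | nil => exact ⟨[], z, by simp, by simp, by simp⟩
  | cons l w ih =>
    obtain ⟨i | j, b⟩ := l
    · obtain ⟨B', z', h1, h2, h3⟩ := ih (B ++ [(z, [(i, b)])]) z
      refine ⟨(z, [(i, b)]) :: B', z', fun Q hQ => ?_, ?_, ?_⟩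
      · have e : blocksWord B ++ embH z ++ (Sum.inl i, b) :: w =
            (blocksWord B ++ embH z ++ embG [(i, b)]) ++ w := by simp [embG]
        rw [e]
        refine Reduces.insert (embH (wordInv z)) ?_
        have := h1 Q (by simpa using hQ)
        simpa [wordInv_embH, wordInv_wordInv, blocksWord, Block.toWord] using this
      · exact h2
      · intro x hx
        rcases List.mem_cons.1 hx with rfl | hx
        · exact ⟨by simp [positions], rfl⟩
        · exact ⟨List.mem_cons_of_mem _ (h3 x hx).1, (h3 x hx).2⟩
    · obtain ⟨B', z', h1, h2, h3⟩ := ih B (z ++ [(j, b)])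
      refine ⟨B', z', fun Q hQ => ?_, ?_, ?_⟩
      · have := h1 Q hQ
        rw [embH_append] at this
        simpa [embH] using this
      · have e : sig ((Sum.inr j, b) :: w) = [(j, b)] ++ sig w := rfl
        rw [h2, e, wordEval_append, wordEval_append, mul_assoc]
      · rw [wordEval_append] at h3
        exact h3

/-- The first among the blocks which are visited earliest can be extracted. -/
theorem exists_extractable {β : Type*} (f : β → H) {e : H} (he : ¬ IsOfFinOrder e) (B : List β)
    (hB : B ≠ []) : ∃ B₁ b B₂, B = B₁ ++ b :: B₂ ∧
      (∀ b' ∈ B₁, ∀ n : ℕ, e ^ n * f b ≠ f b') ∧ ∀ b' ∈ B₂, ∀ n : ℕ, e ^ (n + 1) * f b ≠ f b' := by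
  induction B with
  | nil => exact absurd rfl hB
  | cons a B ih =>
    by_cases hB' : B = []
    · subst hB'
      exact ⟨[], a, [], rfl, by simp, by simp⟩
    obtain ⟨B₁, b, B₂, rfl, h1, h2⟩ := ih hB'
    by_cases h : ∃ n : ℕ, e ^ n * f b = f a
    · obtain ⟨n, hn⟩ := h
      refine ⟨[], a, B₁ ++ b :: B₂, rfl, by simp, fun b' hb' i hi => ?_⟩
      rw [← hn, ← mul_assoc, ← pow_add] at hi
      have e1 : i + 1 + n = (i + n) + 1 := by ring
      rw [List.mem_append, List.mem_cons] at hb'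
      rcases hb' with hb' | rfl | hb'
      · exact h1 b' hb' _ hi
      · rw [mul_eq_right] at hi
        exact he (isOfFinOrder_iff_pow_eq_one.2 ⟨i + 1 + n, by omega, hi⟩)
      · rw [e1] at hi
        exact h2 b' hb' _ hi
    · refine ⟨a :: B₁, b, B₂, rfl, fun b' hb' n hn => ?_, h2⟩
      rcases List.mem_cons.1 hb' with rfl | hb'
      · exact h ⟨n, hn⟩
      · exact h1 b' hb' n hn

theorem Reduces.blocks {e : Word (Fin k)} (he : ¬ IsOfFinOrder (wordEval t e))
    (hc : ∀ x, Reduces t Q (embH x, false))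
    (hH : ∀ x, ¬ IsOfFinOrder (wordEval t x) → Reduces t Q (embH x, true))
    (B : List (Block m k))
    (hB : ∀ b ∈ B, ∀ x, wordEval t x = (wordEval t b.1)⁻¹ * wordEval t e * wordEval t b.1 →
      Reduces t Q (embG b.2 ++ embH x, true)) :
    Reduces t Q (blocksWord B ++ embH e, true) := by
  induction hn : B.length generalizing B with
  | zero =>
    obtain rfl := List.length_eq_zero_iff.1 hn
    exact hH e he
  | succ n ih =>
    obtain ⟨B₁, ⟨z, c⟩, B₂, rfl, h1, h2⟩ := exists_extractable (fun b : Block m k => wordEval t b.1)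
      he B (by rintro rfl; simp at hn)
    refine Reduces.extract he h1 h2 hc (hB (z, c) (by simp) _ (by simp [mul_assoc])) (hH _ ?_)
      (ih _ (fun b hb => hB b ?_) ?_)
    · simpa using he
    · rw [List.mem_append] at hb ⊢
      exact hb.imp_right (List.mem_cons_of_mem _)
    · simp only [List.length_append, List.length_cons] at hn ⊢
      omega

theorem Reduces.power {w : Word (Fin m ⊕ Fin k)} (hw : ¬ IsOfFinOrder (wordEval t (sig w)))
    (hc : ∀ x, Reduces t Q (embH x, false))
    (hH : ∀ x, ¬ IsOfFinOrder (wordEval t x) → Reduces t Q (embH x, true))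
    (hG : ∀ z ∈ positions t 1 w, ∀ c : Word (Fin m), c.length = 1 → ∀ x,
      wordEval t x = z⁻¹ * wordEval t (sig w) * z → Reduces t Q (embG c ++ embH x, true)) :
    Reduces t Q (w, true) := by
  obtain ⟨B, e, h1, h2, h3⟩ := exists_blocks (t := t) w [] []
  simp only [wordEval_nil, one_mul] at h2 h3
  refine h1 Q (Reduces.blocks (h2 ▸ hw) hc hH B fun b hb x hx => ?_)
  rw [h2] at hx
  exact hG _ (h3 b hb).1 _ (h3 b hb).2 x hx

end Reductions

/-! ### Derivability of all expressions -/

section Completeness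

variable {m k : ℕ} {H : Type*} [Group H] {t : Fin k → H}

theorem derivable_of_rule_of_nil {P : RuleParams m k} {r : Rule m k} (hr : r ∈ rules P)
    (hfacts : r.2.2 = []) {p q : List (Word (Fin m ⊕ Fin k) × Bool)}
    (h : ∀ γ ∈ r.2.1, γ.2 = [] ∧ Derivable t (p ++ γ.1 ++ q, [])) :
    Derivable t (p ++ r.1 ++ q, []) := by
  refine Derivable.rule hr (Or.inr rfl) (by simp [hfacts]) fun γ hγ => ?_
  have := h γ hγ
  simpa [plug, this.1] using this.2

theorem derivable_of_torsion (hH : ∀ h : H, IsOfFinOrder h)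
    (E : List (Word (Fin m ⊕ Fin k) × Bool)) : Derivable t (E, []) := by
  have key : ∀ (E p : List (Word (Fin m ⊕ Fin k) × Bool)) (w : Word (Fin m ⊕ Fin k)),
      (∀ a ∈ p, a.2 = true ∧ wordEval t (sig a.1) = 1) →
        Derivable t (p ++ [(w, false)] ++ E, []) := by
    intro E
    induction E with
    | nil =>
      intro p w hp
      rw [List.append_nil]
      refine Derivable.finish ⟨fun a ha h => ?_, fun a ha _ => ?_, fun a ha b hb _ _ => ?_⟩
        (by simp [ValidLoops])
      · simp [(hp a ha).1] at h
      · exact Or.inl (isTrue_factOne.2 (hp a ha).2)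
      · refine Or.inr (Or.inr (Or.inl (isTrue_factOne.2 ?_)))
        simp [(hp a ha).2, (hp b hb).2]
    | cons a E ih =>
      intro p w hp
      obtain ⟨v, b⟩ := a
      have merge : ∀ (p : List (Word (Fin m ⊕ Fin k) × Bool)) (u v : Word (Fin m ⊕ Fin k)),
          (∀ a ∈ p, a.2 = true ∧ wordEval t (sig a.1) = 1) →
          Derivable t (p ++ [(u, false), (v, false)] ++ E, []) := by
        intro p u v hp
        refine derivable_of_rule_of_nil (P := ((u, v, []), default, default, 0))
          (r := ruleMerge u v) (by simp [rules]) rfl ?_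
        simpa [ruleMerge] using ih p (u ++ v) hp
      cases b with
      | false => simpa using merge p w v hp
      | true =>
        obtain ⟨q, hq, hq'⟩ := isOfFinOrder_iff_pow_eq_one.1 (hH (wordEval t (sig v)))
        obtain ⟨q, rfl⟩ := Nat.exists_eq_succ_of_ne_zero hq.ne'
        have e : p ++ [(w, false)] ++ (v, true) :: E = p ++ [(w, false)] ++ [(v, true)] ++ E := by
          simp
        rw [e]
        refine derivable_of_rule_of_nil (P := ((v, [], []), default, default, q))
          (r := ruleMod v q) (by simp [rules]) rfl fun γ hγ => ?_
        obtain ⟨r, -, rfl⟩ := List.mem_map.1 hγ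
        refine ⟨rfl, ?_⟩
        have e : p ++ [(w, false)] ++ [(wordPow v (q + 1), true), (wordPow v r, false)] ++ E =
          p ++ [(w, false), (wordPow v (q + 1), true)] ++ ((wordPow v r, false) :: E) := by simp
        rw [e]
        refine derivable_of_rule_of_nil (P := ((w, wordPow v (q + 1), []), default, default, 0))
          (r := ruleSwap w (wordPow v (q + 1))) (by simp [rules]) rfl ?_
        have := merge (p ++ [(w ++ wordPow v (q + 1) ++ wordInv w, true)]) w (wordPow v r) ?_
        · simpa [ruleSwap] using this
        · intro a ha
          rw [List.mem_append, List.mem_singleton] at ha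
          rcases ha with ha | rfl
          · exact hp a ha
          · refine ⟨rfl, ?_⟩
            simp [sig_wordPow, sig_wordInv, hq']
  refine derivable_of_rule_of_nil (P := default) (r := ruleNil) (p := []) (q := E)
    (by simp [rules]) rfl ?_
  simpa [ruleNil] using key E [] [] (by simp)

/-- Powers are over `GH` or torsion. -/
def IsSimple (t : Fin k → H) (a : Word (Fin m ⊕ Fin k) × Bool) : Prop :=
  a.2 = true → wordEval t (sig a.1) = 1 ∨ ¬ IsOfFinOrder (wordEval t (sig a.1)) ∧
    ∃ (c : Word (Fin m)) (x : Word (Fin k)), c.length ≤ 1 ∧ a.1 = embG c ++ embH x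

/-- The atom is allowed in a normalized expression with the set `U` of values of `σ`. -/
def IsNormal (t : Fin k → H) (U : Set H) (a : Word (Fin m ⊕ Fin k) × Bool) : Prop :=
  (a.2 = false ∧ ∃ x, a.1 = embH x) ∨
  (a.2 = true ∧ (wordEval t (sig a.1) = 1 ∨
    (¬ IsOfFinOrder (wordEval t (sig a.1)) ∧ ∃ x, a.1 = embH x) ∨
    (wordEval t (sig a.1) ∈ U ∧ ∃ (c : Word (Fin m)) (x : Word (Fin k)), c.length = 1 ∧
      a.1 = embG c ++ embH x)))

theorem certifiedNormal_of_isNormal {U : Set H} (h1 : ∀ u ∈ U, ¬ IsOfFinOrder u)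
    (h2 : ∀ u ∈ U, ∀ v ∈ U, Commensurable u v → u = v)
    {p : List (Word (Fin m ⊕ Fin k) × Bool)} (hp : ∀ a ∈ p, IsNormal t U a) :
    CertifiedNormal (Fact.IsTrue t) p := by
  have hU : ∀ g h : H, g = 1 ∨ g ∈ U → h = 1 ∨ h ∈ U → Commensurable g h → g = h := by
    rintro g h (rfl | hg) (rfl | hh) ⟨a, b, ha, hb, hab⟩
    · rfl
    · rw [one_zpow] at hab
      exact absurd (isOfFinOrder_iff_zpow_eq_one.2 ⟨b, hb, hab.symm⟩) (h1 h hh)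
    · rw [one_zpow] at hab
      exact absurd (isOfFinOrder_iff_zpow_eq_one.2 ⟨a, ha, hab⟩) (h1 g hg)
    · exact h2 g hg h hh ⟨a, b, ha, hb, hab⟩
  have hval : ∀ a ∈ p, a.2 = true →
      a.1 = embH (sig a.1) ∨ wordEval t (sig a.1) = 1 ∨ wordEval t (sig a.1) ∈ U := by
    intro a ha hat
    rcases hp a ha with ⟨h3, -⟩ | ⟨-, h3 | ⟨-, x, hx⟩ | ⟨h3, -⟩⟩
    · simp [h3] at hat
    · exact Or.inr (Or.inl h3)
    · rw [hx, sig_embH]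
      exact Or.inl rfl
    · exact Or.inr (Or.inr h3)
  refine ⟨fun a ha h => ?_, fun a ha h => ?_, fun a ha b hb h3 h4 => ?_⟩
  · rcases hp a ha with ⟨-, x, hx⟩ | ⟨h3, -⟩
    · rw [hx, sig_embH]
    · simp [h3] at h
  · rcases hp a ha with ⟨h3, -⟩ | ⟨-, h3 | ⟨h3, x, hx⟩ | ⟨h3, c, x, hc, hx⟩⟩
    · simp [h3] at h
    · exact Or.inl (isTrue_factOne.2 h3)
    · refine Or.inr ⟨isTrue_factNe_self.2 h3, ?_⟩
      have e : (embH x : Word (Fin m ⊕ Fin k)).tail = embH x.tail := List.map_tail.symm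
      rw [hx, e, sig_embH]
    · refine Or.inr ⟨isTrue_factNe_self.2 (h1 _ h3), ?_⟩
      obtain ⟨l, rfl⟩ := List.length_eq_one_iff.1 hc
      have e : (embG [l] ++ embH x : Word (Fin m ⊕ Fin k)).tail = embH x := rfl
      rw [hx, e, sig_embH]
  · refine (hval a ha h3).imp id fun h5 => (hval b hb h4).imp id fun h6 => ?_
    by_cases hc : Commensurable (wordEval t (sig a.1)) (wordEval t (sig b.1))
    · exact Or.inl (isTrue_factOne.2 (by simp [hU _ _ h5 h6 hc]))
    · refine Or.inr ⟨isTrue_factNe₂.2 fun i j hij => hc (commensurable_of_pow hij),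
        isTrue_factNe₂.2 fun i j hij => hc (commensurable_of_pow_inv (a := i) (b := j)
          (by simpa using hij))⟩

theorem derivableAll_of_certifiedNormal {p : List (Word (Fin m ⊕ Fin k) × Bool)}
    (hp : CertifiedNormal (Fact.IsTrue t) p) : DerivableAll t p := by
  intro L hL
  have e : p = p ++ (ruleNil : Rule m k).1 ++ [] := by simp [ruleNil]
  rw [e] at hL ⊢
  refine Derivable.rule (P := default) (by simp [rules]) (Or.inl (by simp [ruleNil]))
    (by simp [ruleNil]) fun γ hγ => ?_
  have hv := isValid_of_mem_rules (P := default) (r := (ruleNil : Rule m k)) (by simp [rules]) γ hγ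
  have h := validLoops_plug (respects_of_length_le_one (by simp [ruleNil]) L) hL hv.2 hv.1
  obtain rfl : γ = ([([], false)], []) := List.mem_singleton.1 hγ
  have e : ∀ I : Gadget (Word (Fin m ⊕ Fin k)), I.1 = p ++ [([], false)] →
      ValidLoops I.1.length I.2 → Derivable t I := by
    rintro ⟨E, L⟩ rfl hL
    exact Derivable.finish hp hL
  exact e _ (by simp [plug]) h

theorem not_isOfFinOrder_conj {g z : H} (h : ¬ IsOfFinOrder g) : ¬ IsOfFinOrder (z⁻¹ * g * z) := by
  intro hfin
  refine h ?_
  obtain ⟨n, hn, hn'⟩ := isOfFinOrder_iff_pow_eq_one.1 hfin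
  refine isOfFinOrder_iff_pow_eq_one.2 ⟨n, hn, ?_⟩
  have := conj_pow (i := n) (a := z⁻¹) (b := g)
  rw [inv_inv, hn'] at this
  have e : g ^ n = z * (z⁻¹ * g ^ n * z) * z⁻¹ := by group
  rw [e, ← this]
  group

theorem reduces_isSimple (a : Word (Fin m ⊕ Fin k) × Bool) : Reduces t (IsSimple t) a := by
  obtain ⟨w, b⟩ := a
  have hc : ∀ w : Word (Fin m ⊕ Fin k), Reduces t (IsSimple t) (w, false) :=
    fun w => Reduces.of_prop (by simp [IsSimple])
  cases b with
  | false => exact hc w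
  | true =>
    by_cases hw : IsOfFinOrder (wordEval t (sig w))
    · obtain ⟨q, hq, hq'⟩ := isOfFinOrder_iff_pow_eq_one.1 hw
      obtain ⟨q, rfl⟩ := Nat.exists_eq_succ_of_ne_zero hq.ne'
      refine Reduces.mod q (Reduces.of_prop fun _ => Or.inl ?_) fun r => hc _
      simpa [sig_wordPow] using hq'
    · refine Reduces.power hw (fun x => hc _) (fun x hx => Reduces.of_prop fun _ => Or.inr ?_)
        fun z _ c hcl x hx => Reduces.of_prop fun _ => Or.inr ?_
      · exact ⟨by simpa using hx, [], x, by simp, by simp [embG]⟩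
      · refine ⟨?_, c, x, hcl.le, rfl⟩
        rw [sig_append, sig_embG, sig_embH, List.nil_append, hx]
        exact not_isOfFinOrder_conj hw

theorem eq_pow_of_mem_positions {c : Word (Fin m)} (hc : c.length = 1) {x : Word (Fin k)} {n : ℕ}
    {z : H} (hz : z ∈ positions t 1 (wordPow (embG c ++ embH x : Word (Fin m ⊕ Fin k)) n)) :
    ∃ i : ℕ, z = wordEval t x ^ i := by
  obtain ⟨l, rfl⟩ := List.length_eq_one_iff.1 hc
  induction n with
  | zero => simp [wordPow_zero, positions] at hz
  | succ n ih =>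
    rw [wordPow_succ, positions_append, List.mem_append] at hz
    rcases hz with hz | hz
    · exact ih hz
    · refine ⟨n, ?_⟩
      have e : ∀ g : H, positions t g (embG [l] ++ embH x : Word (Fin m ⊕ Fin k)) = [g] := by
        intro g
        rw [positions_append, positions_embH]
        rfl
      rw [e, List.mem_singleton] at hz
      simpa [sig_wordPow] using hz

theorem reduces_isNormal {U : Set H} (hU : ∀ u ∈ U, ¬ IsOfFinOrder u) {z₀ : Word (Fin k)}
    (hz₀ : wordEval t z₀ ∈ U) {a : Word (Fin m ⊕ Fin k) × Bool} (ha : IsSimple t a)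
    (hd : ¬ IsOfFinOrder (wordEval t (sig a.1)) → ∃ i : ℕ, ∃ u ∈ U,
      wordEval t (sig a.1) ^ (i + 1) = u ∨ wordEval t (sig a.1) ^ (i + 1) = u⁻¹) :
    Reduces t (IsNormal t U) a := by
  have hcH : ∀ x : Word (Fin k),
      Reduces t (IsNormal t U) ((embH x : Word (Fin m ⊕ Fin k)), false) :=
    fun x => Reduces.of_prop (Or.inl ⟨rfl, x, rfl⟩)
  have hpH : ∀ x : Word (Fin k), ¬ IsOfFinOrder (wordEval t x) →
      Reduces t (IsNormal t U) ((embH x : Word (Fin m ⊕ Fin k)), true) :=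
    fun x hx => Reduces.of_prop (Or.inr ⟨rfl, Or.inr (Or.inl ⟨by simpa using hx, x, rfl⟩)⟩)
  have hpG : ∀ (c : Word (Fin m)) (x : Word (Fin k)), c.length = 1 → wordEval t x ∈ U →
      Reduces t (IsNormal t U) (embG c ++ embH x, true) := fun c x hc hx =>
    Reduces.of_prop (Or.inr ⟨rfl, Or.inr (Or.inr ⟨by simpa using hx, c, x, hc, rfl⟩)⟩)
  have hconst : ∀ w : Word (Fin m ⊕ Fin k), Reduces t (IsNormal t U) (w, false) := by
    intro w
    induction w with
    | nil => exact hcH []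
    | cons l w ih =>
      refine Reduces.split (u := [l]) ?_ ih
      obtain ⟨i | j, b⟩ := l
      · exact Reduces.const (c := [(i, b)]) (hU _ hz₀) (hpG _ _ rfl hz₀) (hcH _)
      · exact hcH [(j, b)]
  obtain ⟨w, b⟩ := a
  cases b with
  | false => exact hconst w
  | true =>
    rcases ha rfl with h1 | ⟨h1, c, x, hc, hx⟩
    · exact Reduces.of_prop (Or.inr ⟨rfl, Or.inl h1⟩)
    · obtain ⟨i, u, hu, hiu⟩ := hd h1
      simp only at hx h1 hiu
      subst hx
      simp only [sig_append, sig_embG, sig_embH, List.nil_append] at h1 hiu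
      rcases Nat.lt_or_ge c.length 1 with hc0 | hc1
      · obtain rfl : c = [] := List.length_eq_zero_iff.1 (by omega)
        exact hpH x h1
      · have hc' : c.length = 1 := le_antisymm hc hc1
        have hpow : wordEval t (sig (wordPow (embG c ++ embH x : Word (Fin m ⊕ Fin k)) (i + 1))) =
            wordEval t x ^ (i + 1) := by
          simp [sig_wordPow]
        refine Reduces.mod i (Reduces.power ?_ hcH hpH fun z hz c' hc' y hy => ?_)
          fun r => hconst _
        · rw [hpow]
          exact fun h => h1 ((isOfFinOrder_pow.1 h).resolve_right (by omega))
        · obtain ⟨j, rfl⟩ := eq_pow_of_mem_positions ‹_› hz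
          have hy' : wordEval t y = wordEval t x ^ (i + 1) := by
            rw [hy, hpow]
            group
          rcases hiu with hiu | hiu
          · exact hpG c' y hc' (by rw [hy', hiu]; exact hu)
          · have hyf : ¬ IsOfFinOrder (wordEval t y) := by
              rw [hy', hiu, isOfFinOrder_inv_iff]
              exact hU u hu
            refine Reduces.reverse hyf hcH (hpH y hyf) (hpG c' _ hc' ?_)
            rw [wordEval_wordInv, hy', hiu, inv_inv]
            exact hu

theorem derivable_of_closure_eq_top (ht : Subgroup.closure (Set.range t) = ⊤)
    (E : List (Word (Fin m ⊕ Fin k) × Bool)) : Derivable t (E, []) := by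
  by_cases htor : ∀ h : H, IsOfFinOrder h
  · exact derivable_of_torsion htor E
  push Not at htor
  obtain ⟨h₀, hh₀⟩ := htor
  classical
  have key : DerivableAll t ([] ++ E ++ []) := by
    refine derivableAll_of_reduces (fun a _ => reduces_isSimple a) fun γ hγ => ?_
    obtain ⟨U, h1, h2, h3⟩ := exists_commensurable_reps
      (h₀ :: (γ.map fun a => wordEval t (sig a.1)).filter fun h => ¬ IsOfFinOrder h)
      (by simp +contextual [hh₀])
    obtain ⟨-, u, hu, -⟩ := h3 h₀ (by simp)
    obtain ⟨z₀, rfl⟩ := exists_wordEval_eq t ht u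
    refine derivableAll_of_reduces (fun a ha => reduces_isNormal h1 hu (hγ a ha) fun hinf => ?_)
      fun γ' hγ' => ?_
    · refine h3 _ (List.mem_cons_of_mem _ (List.mem_filter.2 ⟨List.mem_map_of_mem ha, ?_⟩))
      simpa using hinf
    · simpa using derivableAll_of_certifiedNormal (certifiedNormal_of_isNormal h1 h2 hγ')
  simpa using key [] (by simp [ValidLoops])

end Completeness

/-! ### The theorem -/

section Search

variable {m k : ℕ}

/-- Decode a bound for the table of facts and a sequence of moves, and check whether the moves treat
the expression completely. -/
noncomputable def search (χ : Expr (Word (Fin k)) → Bool) (E : Expr (Word (Fin m ⊕ Fin k)))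
    (n : ℕ) : Option (List (HKPData (Word (Fin m ⊕ Fin k)))) :=
  (Encodable.decode n : Option (ℕ × List (Move m k))).bind fun c =>
    if (run (factTable χ c.1) ([(forget E, [])], []) c.2).1 = [] then
      some ((run (factTable χ c.1) ([(forget E, [])], []) c.2).2.map fun I => (name I.1, I.2))
    else none

theorem computable_search {χ : Expr (Word (Fin k)) → Bool} (hχ : Computable χ) :
    Computable₂ (search χ : Expr (Word (Fin m ⊕ Fin k)) → ℕ → _) := by
  have h1 : Primrec fun x : List (Fact k) × Expr (Word (Fin m ⊕ Fin k)) × List (Move m k) =>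
      run x.1 ([(forget x.2.1, [])], []) x.2.2 := by
    refine primrec_run Primrec.fst (Primrec.pair (primrec_cons (Primrec.pair ?_ (Primrec.const _))
      (Primrec.const _)) (Primrec.const _)) (Primrec.snd.comp Primrec.snd)
    exact primrec_forget.comp (Primrec.fst.comp Primrec.snd)
  have h2 : Primrec fun x : List (Fact k) × Expr (Word (Fin m ⊕ Fin k)) × List (Move m k) =>
      if (run x.1 ([(forget x.2.1, [])], []) x.2.2).1 = [] then
        some ((run x.1 ([(forget x.2.1, [])], []) x.2.2).2.map
          fun I => ((name I.1, I.2) : HKPData (Word (Fin m ⊕ Fin k))))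
      else none := by
    refine Primrec.ite (primrecPred_eq (Primrec.fst.comp h1) (Primrec.const _))
      (Primrec.option_some.comp (Primrec.list_map (Primrec.snd.comp h1) ?_)) (Primrec.const _)
    exact Primrec.pair (primrec_name.comp (Primrec.fst.comp Primrec.snd))
      (Primrec.snd.comp Primrec.snd)
  have h3 : Computable fun x : (Expr (Word (Fin m ⊕ Fin k)) × ℕ) × (ℕ × List (Move m k)) =>
      (factTable χ x.2.1, x.1.1, x.2.2) :=
    ((computable_factTable hχ).comp (Computable.fst.comp Computable.snd)).pair
      ((Computable.fst.comp Computable.fst).pair (Computable.snd.comp Computable.snd))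
  exact Computable.option_bind (Computable.decode.comp Computable.snd) (h2.to_comp.comp h3).to₂

/-- Unbounded search for a total function. -/
theorem exists_computable_of_search {α σ : Type*} [Primcodable α] [Primcodable σ]
    {g : α → ℕ → Option σ} (hg : Computable₂ g) (h : ∀ a, ∃ n b, b ∈ g a n) :
    ∃ f : α → σ, Computable f ∧ ∀ a, ∃ n, f a ∈ g a n :=
  ⟨fun a => (Nat.rfindOpt (g a)).get (Nat.rfindOpt_dom.2 (h a)),
    (Partrec.rfindOpt hg).of_eq_tot fun _ => Part.get_mem _,
    fun _ => Nat.rfindOpt_spec (Part.get_mem _)⟩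

end Search

end WreathKnapsack

theorem mainTheorem1 {G H : Type*} [Group G] [Group H] {m k : ℕ}
    (s : Fin m → G) (hs : Subgroup.closure (Set.range s) = ⊤)
    (t : Fin k → H) (ht : Subgroup.closure (Set.range t) = ⊤)
    (hKP : WreathKnapsack.KPDecidable t) :
    ∃ f : WreathKnapsack.Expr (WreathKnapsack.Word (Fin m ⊕ Fin k)) →
        List (WreathKnapsack.HKPData (WreathKnapsack.Word (Fin m ⊕ Fin k))),
      Computable f ∧
      ∀ E : WreathKnapsack.Expr (WreathKnapsack.Word (Fin m ⊕ Fin k)), E.IsKnapsack →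
        (∀ I ∈ f E, I.IsInstance ∧
          (I.1.map (WreathKnapsack.wordEval (WreathKnapsack.Wreath.gens s t))).IsNormalized) ∧
        ((E.map (WreathKnapsack.wordEval (WreathKnapsack.Wreath.gens s t))).sol.Nonempty ↔
          (⋃ I ∈ f E,
            (I.map (WreathKnapsack.wordEval (WreathKnapsack.Wreath.gens s t))).sol).Nonempty) := by
  open WreathKnapsack in
  obtain ⟨χ, hχ, hχ'⟩ := ComputablePred.computable_iff.1 hKP
  have hfact : ∀ x : Fact k, x.IsTrue t ↔ x.2 = χ x.1 := by
    rintro ⟨e, b⟩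
    have := congrFun hχ' e
    simp only [eq_iff_iff] at this
    rw [Fact.IsTrue, this]
    exact Bool.eq_iff_iff.symm
  have hT : ∀ n, ∀ x ∈ factTable χ n, x.IsTrue t := fun n x hx => (hfact x).2 (mem_factTable hx)
  have htotal : ∀ E : Expr (Word (Fin m ⊕ Fin k)), ∃ n b, b ∈ search χ E n := by
    intro E
    obtain ⟨mvs, out, h⟩ := (derivable_of_closure_eq_top ht (forget E)).exists_treats
      (T := factTable χ) fun x hx => eventually_mem_factTable ((hfact x).1 hx)
    obtain ⟨N, hN⟩ := (h [] []).exists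
    refine ⟨Encodable.encode (N, mvs), out.map fun I => (name I.1, I.2), ?_⟩
    simp only [List.append_nil] at hN
    simp [search, hN]
  obtain ⟨f, hf, hf'⟩ := exists_computable_of_search (computable_search hχ) htotal
  refine ⟨f, hf, fun E hE => ?_⟩
  obtain ⟨n, hn⟩ := hf' E
  obtain ⟨⟨N, mvs⟩, -, hc⟩ := Option.bind_eq_some_iff.1 hn
  split_ifs at hc with hnil
  simp only [Option.some.injEq] at hc
  obtain ⟨h1, h2⟩ := run_sound (s := s) (hT N) ([(forget E, [])], []) mvs
  have h3 := h2 (by simp)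
  rw [State.IsSolvable, State.IsSolvable, hnil] at h1
  simp only [List.not_mem_nil, false_and, exists_false, false_or, or_false, List.mem_singleton,
    exists_eq_left] at h1
  rw [← hc]
  refine ⟨?_, ?_⟩
  · intro J hJ
    obtain ⟨I, hI, rfl⟩ := List.mem_map.1 hJ
    exact ⟨⟨isKnapsack_name _, by rw [length_name]; exact (h3 I hI).1⟩, (h3 I hI).2⟩
  · rw [nonempty_sol_iff _ hE]
    refine h1.symm.trans ?_
    simp only [Set.nonempty_iUnion, List.mem_map, exists_prop, exists_exists_and_eq_and]
    refine exists_congr fun I => and_congr_right fun hI => ?_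
    rw [nonempty_hkpSol_iff _ (isKnapsack_name _) (by rw [length_name]; exact (h3 I hI).1),
      forget_name]
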